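/- Let $d\ge 1$ and consider an insurance company with $d$ lines of business. Claims arrive at the times $T_n=Y_1+\dots+Y_n$, $n\ge1$, where the interarrival times $(Y_i)_{i\ge 1}$ are i.i.d. and (almost surely) positive; put $N_t=\sup\{n\ge 1: T_n\le t\}$ ($\sup\emptyset=0$). The claim sizes $(\mathbf X^{(i)})_{i\ge1}$ are i.i.d. random vectors in $\mathbb R^d$ with finite mean, independent of $(Y_i)_{i\ge 1}$; $\mathbf X$ and $Y$ denote a generic claim and interarrival time. Let $\mathbf p\in[0,\infty)^d$ be the vector of premium rates, let $\mathbf b\in(0,\infty)^d$ with $b_1+\dots+b_d=1$, and assume that $\mathbf X-Y\mathbf p$ has finite mean and that $\mathbf c:=-\mathbb E[\mathbf X-Y\mathbf p]$ has all coordinates $c_j>0$. For $u>0$ let $$\mathbf R_t=u\mathbf b+t\mathbf p-\sum_{i=1}^{N_t}\mathbf X^{(i)},\qquad \psi_{\mathbf b,L}(u)=P\bigl(\mathbf R_t\in L\text{ for some }t\ge 0\bigr).$$ Let the ruin set $L\subset\mathbb R^d$ be open and decreasing (if $\mathbf x\in L$ and $\mathbf a\in[0,\infty)^d$, then $\mathbf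 x-\mathbf a\in L$), with $\mathbf 0\in\partial L$, $uL=L$ for all $u>0$, and $L^c$ convex. Let $\|\cdot\|$ be the $L_1$ norm on $\mathbb R^d$. Suppose that $\mathbf X$ is multivariate regularly varying with exponent $\alpha>1$ and tail measure $\mu$: $\mu$ is a non-zero Radon measure on $[-\infty,\infty]^d\setminus\{\mathbf 0\}$ which charges only finite points, normalized so that $$\frac{P(\mathbf X\in u\,\cdot)}{P(\|\mathbf X\|>u)}\stackrel{v}{\longrightarrow}\mu\qquad(u\to\infty)$$ vaguely on $[-\infty,\infty]^d\setminus\{\mathbf 0\}$, and $\mu(uB)=u^{-\alpha}\mu(B)$ for all $u>0$ and all Borel sets $B\subset\mathbb R^d\setminus\{\mathbf 0\}$. Suppose also that $\mu\{\mathbf x\in\mathbb R^d: x_j>0\}>0$ for each $j=1,\dots,d$. **Proposition.** Under these assumptions the integral below is finite, and $$\lim_{u\to\infty}\frac{\psi_{\mathbf b,L}(u)}{u\,P(\|\mathbf X\|>u)}=\int_0^\infty\mu(\mathbf b-L+v\mathbf c)\,dv .$$ -/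

import Mathlib

open MeasureTheory ProbabilityTheory Filter Topology Set
open scoped Pointwise ENNReal CompactlySupported

/-- The `L¹` norm on `ℝ^d`. -/
def l1Norm {d : ℕ} (x : Fin d → ℝ) : ℝ := ∑ i, |x i|

/-- The punctured compactified space `[-∞, ∞]^d ∖ {0}`, with the subspace topology of the product
topology and the corresponding Borel σ-algebra. -/
abbrev PuncturedExt (d : ℕ) : Type := ↥({0}ᶜ : Set (Fin d → EReal))

/-- The points of `[-∞, ∞]^d ∖ {0}` which are (finite and) in the subset `A` of `ℝ^d`. -/
def finitePoints {d : ℕ} (A : Set (Fin d → ℝ)) : Set (PuncturedExt d) :=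
  {x | ∃ y ∈ A, ∀ i, x.1 i = (y i : EReal)}

/-- The measure `B ↦ F (u B)` on `[-∞, ∞]^d ∖ {0}`, that is, the law of `X / u` restricted to that
space, where `X` has law `F`. -/
noncomputable def scaledLaw {d : ℕ} (F : Measure (Fin d → ℝ)) (u : ℝ) :
    Measure (PuncturedExt d) :=
  (F.map (fun x i => ((x i / u : ℝ) : EReal))).comap Subtype.val

/-- Vague convergence of measures: convergence of the integrals of all continuous functions
with compact support. -/
def VagueTendsto {ι E : Type*} [TopologicalSpace E] [MeasurableSpace E]
    (ν : ι → Measure E) (l : Filter ι) (μ : Measure E) : Prop :=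
  ∀ f : C_c(E, ℝ), Tendsto (fun i => ∫ x, f x ∂(ν i)) l (𝓝 (∫ x, f x ∂μ))

/-- The law `F` on `ℝ^d` is multivariate regularly varying with exponent `α` and tail measure `μ`,
where `μ` is scaled in such a way that `F (u ·) / F {‖x‖₁ > u}` converges vaguely to `μ`
(in particular `μ {‖x‖₁ > 1} = 1`). The exponent `α` is the one given by the homogeneity of `μ`.
As `[-∞, ∞]^d ∖ {0}` is locally compact and second countable, a Borel measure on it is Radon if
and only if it is finite on compact sets. -/
structure IsMRV {d : ℕ} (F : Measure (Fin d → ℝ)) (α : ℝ) (μ : Measure (PuncturedExt d)) :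
    Prop where
  exponent_pos : 0 < α
  radon : IsFiniteMeasureOnCompacts μ
  ne_zero : μ ≠ 0
  charges_finite : μ {x | ∃ i, x.1 i = ⊤ ∨ x.1 i = ⊥} = 0
  vague : VagueTendsto (fun u : ℝ => (F {x | u < l1Norm x})⁻¹ • scaledLaw F u) atTop μ
  scaling : ∀ u : ℝ, 0 < u → ∀ A : Set (Fin d → ℝ), MeasurableSet A →
    μ (finitePoints (u • A)) = ENNReal.ofReal (u ^ (-α)) * μ (finitePoints A)

/-- The assumption on the ruin set: an open decreasing cone with the origin on its boundary and
with convex complement. -/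
structure IsRuinSet {d : ℕ} (L : Set (Fin d → ℝ)) : Prop where
  isOpen : IsOpen L
  decreasing : IsLowerSet L
  zero_mem_frontier : (0 : Fin d → ℝ) ∈ frontier L
  cone : ∀ u : ℝ, 0 < u → u • L = L
  convex_compl : Convex ℝ Lᶜ

section RiskModel

variable {Ω : Type*} {d : ℕ}

/-- The arrival time `T n` of the `n`-th claim; `Y i` is the `(i + 1)`-st interarrival time. -/
def arrivalTime (Y : ℕ → Ω → ℝ) (n : ℕ) (ω : Ω) : ℝ := ∑ i ∈ Finset.range n, Y i ω

/-- The number `N t = sup {n ≥ 1 : T n ≤ t}` of claims up to time `t`, with `sup ∅ = 0`. (The set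
is almost surely bounded if the interarrival times are i.i.d. and positive.) -/
noncomputable def claimCount (Y : ℕ → Ω → ℝ) (t : ℝ) (ω : Ω) : ℕ :=
  sSup {n : ℕ | 1 ≤ n ∧ arrivalTime Y n ω ≤ t}

/-- The claim surplus process `S t`; `X i` is the `(i + 1)`-st claim. -/
noncomputable def claimSurplus (X : ℕ → Ω → Fin d → ℝ) (Y : ℕ → Ω → ℝ) (p : Fin d → ℝ)
    (t : ℝ) (ω : Ω) : Fin d → ℝ :=
  (∑ i ∈ Finset.range (claimCount Y t ω), X i ω) - t • p

/-- The risk reserve process `R t = u b - S t`. -/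
noncomputable def riskReserve (X : ℕ → Ω → Fin d → ℝ) (Y : ℕ → Ω → ℝ) (p b : Fin d → ℝ)
    (u t : ℝ) (ω : Ω) : Fin d → ℝ :=
  u • b - claimSurplus X Y p t ω

/-- The ruin probability: the probability that the risk reserve process, with initial capital
`u b`, ever hits `L`. -/
noncomputable def ruinProb [MeasurableSpace Ω] (P : Measure Ω) (X : ℕ → Ω → Fin d → ℝ)
    (Y : ℕ → Ω → ℝ) (p b : Fin d → ℝ) (L : Set (Fin d → ℝ)) (u : ℝ) : ℝ :=
  P.real {ω | ∃ t : ℝ, 0 ≤ t ∧ riskReserve X Y p b u t ω ∈ L}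

end RiskModel

/-! The mechanism is the principle of one big jump. Premiums only raise the reserve, so ruin is
decided at claim times: it depends on the random walk with steps `Z i = X i - Y i • p`, whose drift
is `-c`. As `L` is a decreasing open cone with convex complement, the Minkowski functional `g` of
`{x | b - x ∈ Lᶜ}` is monotone and subadditive, and `u • b - x ∈ L` iff `u < g x`. Ruin thus becomes
the exceedance of the level `u` by `g` along the walk.

By the law of large numbers the walk is near `-n • c` after `n` steps, so a high level is reached
essentially when a single claim `x` satisfies `u < g (x - n • c)`. Summed over `n`, these
probabilities are close to the integral over `v > 0` of `F {x | u < g (x - v • c)}`. The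
substitution of `u * v` for `v`, regular variation and dominated convergence
(`IsMRV.tendsto_lintegral`) turn this integral into `u * F {x | u < l1Norm x}` times the asserted
constant.

For the lower bound, `le_measure_exceedance` uses the disjoint events that the first big step is the
one with index `n` while the walk is still above a slightly steeper line. For the upper bound,
`measure_exceedance_le` splits at the first crossing of a slightly flatter line, which with high
probability is never crossed. The walk after the crossing is a fresh copy, whence a renewal type
inequality in which the exceedance probability reappears with a small coefficient.
`eventually_le_of_renewal_inequality` solves it, first up to a constant and then with the sharp
constant. -/

/-! ### Portmanteau bounds for vague convergence. -/

section VagueConvergence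

variable {ι E : Type*} [TopologicalSpace E] [MeasurableSpace E] [BorelSpace E] [T2Space E]
  [LocallyCompactSpace E] {ν : ι → Measure E} {l : Filter ι} {μ : Measure E}

/-- Lower bound of the portmanteau theorem for vague convergence. -/
theorem VagueTendsto.eventually_lt_of_isOpen [μ.Regular] (h : VagueTendsto ν l μ) {O : Set E}
    (hO : IsOpen O) {a : ℝ≥0∞} (ha : a < μ O) : ∀ᶠ i in l, a < ν i O := by
  obtain ⟨K, hKO, hK, haK⟩ := hO.exists_lt_isCompact ha
  obtain ⟨f, hf1, hfc, hfs, hf01⟩ := exists_continuousMap_one_of_isCompact_subset_isOpen hK hO hKO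
  let F : C_c(E, ℝ) := ⟨f, hfc⟩
  have hF : ∀ x, F x = f x := fun _ => rfl
  have hint : Integrable F μ := F.continuous.integrable_of_hasCompactSupport hfc
  have hKfin : μ K < ∞ := hK.measure_lt_top
  have hKint : μ.real K ≤ ∫ x, F x ∂μ := by
    rw [← integral_indicator_one hK.measurableSet]
    refine integral_mono_of_nonneg (Eventually.of_forall fun x => ?_) hint
      (Eventually.of_forall fun x => ?_)
    · exact indicator_nonneg (fun _ _ => zero_le_one) x
    · refine indicator_le' (fun y hy => ?_) (fun y _ => ?_) x
      · rw [hF, hf1 hy]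
      · exact (hf01 y).1
  have hapos : a.toReal < ∫ x, F x ∂μ :=
    lt_of_lt_of_le ((ENNReal.toReal_lt_toReal haK.ne_top hKfin.ne).2 haK) hKint
  filter_upwards [(h F).eventually (lt_mem_nhds hapos)] with i hi
  have h1 : a < ENNReal.ofReal (∫ x, F x ∂(ν i)) :=
    (ENNReal.lt_ofReal_iff_toReal_lt haK.ne_top).2 hi
  refine h1.trans_le ?_
  rw [integral_eq_lintegral_of_nonneg_ae (f := F) (Eventually.of_forall fun x => (hf01 x).1)
    F.continuous.aestronglyMeasurable]
  -- No integrability with respect to `ν i` is needed: an infinite integral becomes `0` here, which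
  -- only helps.
  refine ENNReal.ofReal_toReal_le.trans ?_
  rw [← lintegral_indicator_one hO.measurableSet]
  refine lintegral_mono fun x => ?_
  by_cases hx : x ∈ O
  · rw [indicator_of_mem hx]
    exact ENNReal.ofReal_le_one.2 (hf01 x).2
  · have : F x = 0 := image_eq_zero_of_notMem_tsupport fun hx' => hx (hfs hx')
    simp [this]

/-- Upper bound of the portmanteau theorem for vague convergence. -/
theorem VagueTendsto.eventually_lt_of_isCompact [μ.Regular] (h : VagueTendsto ν l μ) {K : Set E}
    (hK : IsCompact K) (hfin : ∀ᶠ i in l, IsFiniteMeasure (ν i)) {a : ℝ≥0∞} (ha : μ K < a) :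
    ∀ᶠ i in l, ν i K < a := by
  obtain ⟨O, hKO, hO, haO⟩ := exists_isOpen_lt_of_lt K a ha
  obtain ⟨f, hf1, hfc, hfs, hf01⟩ := exists_continuousMap_one_of_isCompact_subset_isOpen hK hO hKO
  let F : C_c(E, ℝ) := ⟨f, hfc⟩
  have hF : ∀ x, F x = f x := fun _ => rfl
  have hnn : ∀ x, 0 ≤ F x := fun x => (hf01 x).1
  have hint : Integrable F μ := F.continuous.integrable_of_hasCompactSupport hfc
  have hle : ENNReal.ofReal (∫ x, F x ∂μ) < a := by
    refine lt_of_le_of_lt ?_ haO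
    rw [ofReal_integral_eq_lintegral_ofReal hint (Eventually.of_forall hnn),
      ← lintegral_indicator_one hO.measurableSet]
    refine lintegral_mono fun x => ?_
    by_cases hx : x ∈ O
    · rw [indicator_of_mem hx]
      exact ENNReal.ofReal_le_one.2 (hf01 x).2
    · have : F x = 0 := image_eq_zero_of_notMem_tsupport fun hx' => hx (hfs hx')
      simp [this]
  have hlim := (ENNReal.continuous_ofReal.tendsto _).comp (h F)
  filter_upwards [hlim.eventually (gt_mem_nhds hle), hfin] with i hi hifin
  refine lt_of_le_of_lt ?_ hi
  -- Finiteness of `ν i` excludes the default value `0` of the integral of a non-integrable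
  -- function, which would make the upper bound void.
  have hint' : Integrable F (ν i) := F.continuous.integrable_of_hasCompactSupport hfc
  simp only [Function.comp]
  rw [ofReal_integral_eq_lintegral_ofReal hint' (Eventually.of_forall hnn),
    ← lintegral_indicator_one hK.measurableSet]
  refine lintegral_mono fun x => ?_
  by_cases hx : x ∈ K
  · rw [hF, hf1 hx]
    simp [hx]
  · simp [hx]

end VagueConvergence

/-! ### Passage between the compactified space and `ℝ^d`. -/

section TailMeasure

variable {d : ℕ}

/-- The embedding of `ℝ^d` into `[-∞, ∞]^d`. -/
def toExt (x : Fin d → ℝ) : Fin d → EReal := fun i => (x i : EReal)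

theorem isOpenEmbedding_toExt : IsOpenEmbedding (toExt (d := d)) :=
  IsOpenEmbedding.piMap fun _ => EReal.isOpenEmbedding_coe

theorem toExt_eq_zero {x : Fin d → ℝ} : toExt x = 0 ↔ x = 0 := by
  constructor
  · intro h
    funext i
    have := congrFun h i
    simpa [toExt] using this
  · rintro rfl
    funext i
    simp [toExt]

theorem finitePoints_eq (A : Set (Fin d → ℝ)) :
    finitePoints A = Subtype.val ⁻¹' (toExt '' A) := by
  ext x
  constructor
  · rintro ⟨y, hy, h⟩
    exact ⟨y, hy, funext fun i => (h i).symm⟩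
  · rintro ⟨y, hy, h⟩
    exact ⟨y, hy, fun i => (congrFun h i).symm⟩

theorem isOpen_finitePoints {A : Set (Fin d → ℝ)} (hA : IsOpen A) :
    IsOpen (finitePoints A) := by
  rw [finitePoints_eq]
  exact (isOpenEmbedding_toExt.isOpenMap A hA).preimage continuous_subtype_val

/-- The projection of `[-∞, ∞]^d ∖ {0}` to `ℝ^d` which replaces infinite coordinates by `0`. -/
def toRealVec (x : PuncturedExt d) : Fin d → ℝ := fun i => (x.1 i).toReal

theorem measurable_toRealVec : Measurable (toRealVec (d := d)) :=
  measurable_pi_lambda _ fun i =>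
    measurable_ereal_toReal.comp ((measurable_pi_apply i).comp measurable_subtype_coe)

/-- The measure on `ℝ^d` induced by a measure on `[-∞, ∞]^d ∖ {0}`. -/
noncomputable def realMeasure (μ : Measure (PuncturedExt d)) : Measure (Fin d → ℝ) :=
  μ.map toRealVec

theorem realMeasure_apply {μ : Measure (PuncturedExt d)}
    (hμ : μ {x | ∃ i, x.1 i = ⊤ ∨ x.1 i = ⊥} = 0) {A : Set (Fin d → ℝ)} (hA : MeasurableSet A) :
    realMeasure μ A = μ (finitePoints A) := by
  rw [realMeasure, Measure.map_apply measurable_toRealVec hA]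
  refine measure_congr ?_
  have : ∀ᵐ x ∂μ, ¬ ∃ i, x.1 i = ⊤ ∨ x.1 i = ⊥ := by
    rw [ae_iff]
    simpa only [not_not] using hμ
  filter_upwards [this] with x hx
  push Not at hx
  refine propext ⟨fun h => ⟨toRealVec x, h, fun i => ?_⟩, ?_⟩
  · exact (EReal.coe_toReal (hx i).1 (hx i).2).symm
  · rintro ⟨y, hy, h⟩
    have : toRealVec x = y := funext fun i => by simp [toRealVec, h i]
    change toRealVec x ∈ A
    rwa [this]

theorem scaledLaw_apply (F : Measure (Fin d → ℝ)) (u : ℝ) {B : Set (PuncturedExt d)}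
    (hB : MeasurableSet B) :
    scaledLaw F u B = F ((fun x => toExt (u⁻¹ • x)) ⁻¹' (Subtype.val '' B)) := by
  have hmeas : MeasurableSet ({0}ᶜ : Set (Fin d → EReal)) := (measurableSet_singleton 0).compl
  have hfun : (fun (x : Fin d → ℝ) i => ((x i / u : ℝ) : EReal)) = fun x => toExt (u⁻¹ • x) := by
    funext x i
    simp [toExt, div_eq_inv_mul]
  rw [scaledLaw, comap_subtype_coe_apply hmeas, hfun, Measure.map_apply]
  · exact isOpenEmbedding_toExt.continuous.measurable.comp (measurable_const_smul _)
  · exact hmeas.subtype_image hB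

theorem scaledLaw_finitePoints (F : Measure (Fin d → ℝ)) (u : ℝ) {A : Set (Fin d → ℝ)}
    (hA : MeasurableSet A) (h0 : (0 : Fin d → ℝ) ∉ A) :
    scaledLaw F u (finitePoints A) = F ((fun x => u⁻¹ • x) ⁻¹' A) := by
  rw [scaledLaw_apply]
  · congr 1
    ext x
    simp only [mem_preimage, finitePoints_eq, Subtype.image_preimage_coe, mem_inter_iff,
      isOpenEmbedding_toExt.injective.mem_set_image, mem_compl_iff, mem_singleton_iff,
      toExt_eq_zero]
    exact ⟨fun h => h.2, fun h => ⟨fun h' => h0 (h' ▸ h), h⟩⟩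
  · rw [finitePoints_eq]
    exact measurable_subtype_coe (isOpenEmbedding_toExt.measurableEmbedding.measurableSet_image.2 hA)

theorem scaledLaw_compl_finitePoints (F : Measure (Fin d → ℝ)) (u : ℝ) {A : Set (Fin d → ℝ)}
    (hA : MeasurableSet A) (h0 : (0 : Fin d → ℝ) ∈ A) :
    scaledLaw F u (finitePoints A)ᶜ = F ((fun x => u⁻¹ • x) ⁻¹' Aᶜ) := by
  rw [scaledLaw_apply]
  · congr 1
    ext x
    simp only [mem_preimage, finitePoints_eq, ← preimage_compl, Subtype.image_preimage_coe,
      mem_inter_iff, isOpenEmbedding_toExt.injective.mem_set_image, mem_compl_iff,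
      mem_singleton_iff, toExt_eq_zero]
    exact ⟨fun h => h.2, fun h => ⟨fun h' => h (h' ▸ h0), h⟩⟩
  · rw [finitePoints_eq]
    exact (measurable_subtype_coe
      (isOpenEmbedding_toExt.measurableEmbedding.measurableSet_image.2 hA)).compl

/-- A neighbourhood of the origin is removed from a compact space, so the infinite points are
harmless. This is what the compactification is for. -/
theorem isCompact_compl_finitePoints {A : Set (Fin d → ℝ)} (hA : IsOpen A)
    (h0 : (0 : Fin d → ℝ) ∈ A) : IsCompact (finitePoints A)ᶜ := by
  have h1 : IsCompact (toExt '' A)ᶜ := (isOpenEmbedding_toExt.isOpenMap A hA).isClosed_compl.isCompact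
  rw [finitePoints_eq, ← preimage_compl]
  refine Topology.IsInducing.subtypeVal.isCompact_preimage' h1 ?_
  rintro x hx
  simp only [Subtype.range_coe, mem_compl_iff, mem_singleton_iff]
  rintro rfl
  exact hx ⟨0, h0, toExt_eq_zero.2 rfl⟩

/-- The complement on the left also contains all points with an infinite coordinate, but they carry
no mass. -/
theorem measure_compl_finitePoints {μ : Measure (PuncturedExt d)}
    (hμ : μ {x | ∃ i, x.1 i = ⊤ ∨ x.1 i = ⊥} = 0) {A : Set (Fin d → ℝ)} (hA : MeasurableSet A) :
    μ (finitePoints A)ᶜ = realMeasure μ Aᶜ := by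
  rw [realMeasure_apply hμ hA.compl]
  refine measure_congr ?_
  have : ∀ᵐ x ∂μ, ¬ ∃ i, x.1 i = ⊤ ∨ x.1 i = ⊥ := by
    rw [ae_iff]
    simpa only [not_not] using hμ
  filter_upwards [this] with x hx
  push Not at hx
  refine propext ⟨fun h => ⟨toRealVec x, fun h' => h ?_, fun i => ?_⟩, ?_⟩
  · exact ⟨_, h', fun i => (EReal.coe_toReal (hx i).1 (hx i).2).symm⟩
  · exact (EReal.coe_toReal (hx i).1 (hx i).2).symm
  · rintro ⟨y, hy, h⟩ ⟨z, hz, h'⟩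
    apply hy
    have : y = z := funext fun i => by
      have := (h i).symm.trans (h' i)
      exact_mod_cast this
    rwa [this]

end TailMeasure

/-! ### The `L¹` norm. -/

section L1Norm

variable {d : ℕ}

theorem continuous_l1Norm : Continuous (l1Norm (d := d)) := by
  unfold l1Norm
  fun_prop

theorem l1Norm_nonneg (x : Fin d → ℝ) : 0 ≤ l1Norm x :=
  Finset.sum_nonneg fun _ _ => abs_nonneg _

theorem l1Norm_zero : l1Norm (0 : Fin d → ℝ) = 0 := by simp [l1Norm]

theorem abs_le_l1Norm (x : Fin d → ℝ) (i : Fin d) : |x i| ≤ l1Norm x :=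
  Finset.single_le_sum (f := fun i => |x i|) (fun _ _ => abs_nonneg _) (Finset.mem_univ i)

theorem l1Norm_pos {x : Fin d → ℝ} (hx : x ≠ 0) : 0 < l1Norm x := by
  obtain ⟨i, hi⟩ := Function.ne_iff.1 hx
  exact (abs_pos.2 hi).trans_le (abs_le_l1Norm x i)

theorem l1Norm_smul {r : ℝ} (hr : 0 ≤ r) (x : Fin d → ℝ) : l1Norm (r • x) = r * l1Norm x := by
  simp [l1Norm, abs_mul, abs_of_nonneg hr, Finset.mul_sum]

theorem lt_l1Norm_inv_smul {r u : ℝ} (hu : 0 < u) (x : Fin d → ℝ) :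
    r < l1Norm (u⁻¹ • x) ↔ r * u < l1Norm x := by
  rw [l1Norm_smul (inv_nonneg.2 hu.le), inv_mul_eq_div, lt_div_iff₀ hu]

end L1Norm

/-! ### Limits of the scaled law on subsets of `ℝ^d`. -/

namespace IsMRV

variable {d : ℕ} {F : Measure (Fin d → ℝ)} {α : ℝ} {μ : Measure (PuncturedExt d)}

theorem regular (h : IsMRV F α μ) : μ.Regular := by
  have := h.radon
  have : LocallyCompactSpace (PuncturedExt d) :=
    (isOpen_compl_singleton (x := (0 : Fin d → EReal))).locallyCompactSpace
  exact Measure.Regular.of_sigmaCompactSpace_of_isLocallyFiniteMeasure μ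

theorem eventually_lt_of_isOpen (h : IsMRV F α μ) {U : Set (Fin d → ℝ)} (hU : IsOpen U)
    (h0 : (0 : Fin d → ℝ) ∉ U) {a : ℝ≥0∞} (ha : a < realMeasure μ U) :
    ∀ᶠ u : ℝ in atTop, a < (F {x | u < l1Norm x})⁻¹ * F {x | u⁻¹ • x ∈ U} := by
  have := h.regular
  have : LocallyCompactSpace (PuncturedExt d) :=
    (isOpen_compl_singleton (x := (0 : Fin d → EReal))).locallyCompactSpace
  rw [realMeasure_apply h.charges_finite hU.measurableSet] at ha
  filter_upwards [h.vague.eventually_lt_of_isOpen (isOpen_finitePoints hU) ha] with u hu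
  rwa [Measure.smul_apply, scaledLaw_finitePoints F u hU.measurableSet h0, smul_eq_mul] at hu

theorem realMeasure_singleton_zero (h : IsMRV F α μ) : realMeasure μ {0} = 0 := by
  rw [realMeasure_apply h.charges_finite (measurableSet_singleton 0)]
  convert measure_empty (μ := μ)
  rw [eq_empty_iff_forall_notMem]
  rintro x ⟨y, rfl, hx⟩
  refine x.2 ?_
  simp only [mem_singleton_iff]
  funext i
  simpa using hx i

/-- If one tail vanished, so would all later ones, and the lower portmanteau bound would leave `μ`
no mass off the origin. Hence the normalizing inverse is never `∞`. -/
theorem tail_ne_zero (h : IsMRV F α μ) (u : ℝ) : F {x | u < l1Norm x} ≠ 0 := by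
  intro hu0
  have key : ∀ r : ℝ, 0 < r → realMeasure μ {x | r < l1Norm x} = 0 := by
    intro r hr
    by_contra hne
    have hopen : IsOpen {x : Fin d → ℝ | r < l1Norm x} :=
      isOpen_lt continuous_const continuous_l1Norm
    have := h.eventually_lt_of_isOpen hopen (by simp [l1Norm_zero, hr.le]) (pos_iff_ne_zero.2 hne)
    obtain ⟨w, hw, hw1, hw2⟩ := (this.and ((eventually_gt_atTop 0).and
      (eventually_ge_atTop (u / r)))).exists
    have hz : F {x | w⁻¹ • x ∈ {x : Fin d → ℝ | r < l1Norm x}} = 0 := by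
      refine measure_mono_null (fun x hx => ?_) hu0
      simp only [mem_ofPred_eq, lt_l1Norm_inv_smul hw1] at hx ⊢
      rw [div_le_iff₀ hr] at hw2
      linarith
    rw [hz, mul_zero] at hw
    exact lt_irrefl _ hw
  apply h.ne_zero
  rw [← Measure.measure_univ_eq_zero]
  have h1 : realMeasure μ univ = 0 := by
    have : (univ : Set (Fin d → ℝ)) ⊆
        {0} ∪ ⋃ n : ℕ, {x | 1 / ((n : ℝ) + 1) < l1Norm x} := by
      intro x _
      by_cases hx : x = 0
      · exact Or.inl hx
      · obtain ⟨n, hn⟩ := exists_nat_one_div_lt (l1Norm_pos hx)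
        exact Or.inr (mem_iUnion.2 ⟨n, hn⟩)
    refine measure_mono_null this (measure_union_null h.realMeasure_singleton_zero ?_)
    exact measure_iUnion_null fun n => key _ (by positivity)
  rwa [realMeasure, Measure.map_apply measurable_toRealVec MeasurableSet.univ, preimage_univ] at h1

/-- The portmanteau bound is applied to the compact complement of `finitePoints Cᶜ`, which is `C`
together with the infinite points. -/
theorem eventually_lt_of_isClosed [IsFiniteMeasure F] (h : IsMRV F α μ) {C : Set (Fin d → ℝ)}
    (hC : IsClosed C) (h0 : (0 : Fin d → ℝ) ∉ C) {a : ℝ≥0∞} (ha : realMeasure μ C < a) :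
    ∀ᶠ u : ℝ in atTop, (F {x | u < l1Norm x})⁻¹ * F {x | u⁻¹ • x ∈ C} < a := by
  have := h.regular
  have : LocallyCompactSpace (PuncturedExt d) :=
    (isOpen_compl_singleton (x := (0 : Fin d → EReal))).locallyCompactSpace
  have hfin : ∀ u : ℝ, IsFiniteMeasure ((F {x | u < l1Norm x})⁻¹ • scaledLaw F u) := by
    intro u
    refine ⟨?_⟩
    rw [Measure.smul_apply, scaledLaw_apply F u MeasurableSet.univ, smul_eq_mul]
    exact ENNReal.mul_lt_top (ENNReal.inv_lt_top.2 (pos_iff_ne_zero.2 (h.tail_ne_zero u)))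
      (measure_lt_top _ _)
  have hmem : (0 : Fin d → ℝ) ∈ Cᶜ := h0
  have ha' : μ (finitePoints Cᶜ)ᶜ < a := by
    rwa [measure_compl_finitePoints h.charges_finite hC.measurableSet.compl, compl_compl]
  filter_upwards [h.vague.eventually_lt_of_isCompact
    (isCompact_compl_finitePoints hC.isOpen_compl hmem) (Eventually.of_forall hfin) ha'] with u hu
  rwa [Measure.smul_apply, scaledLaw_compl_finitePoints F u hC.measurableSet.compl hmem,
    smul_eq_mul, compl_compl] at hu

theorem realMeasure_smul (h : IsMRV F α μ) {r : ℝ} (hr : 0 < r) {A : Set (Fin d → ℝ)}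
    (hA : MeasurableSet A) :
    realMeasure μ (r • A) = ENNReal.ofReal (r ^ (-α)) * realMeasure μ A := by
  rw [realMeasure_apply h.charges_finite hA,
    realMeasure_apply h.charges_finite (hA.const_smul_of_ne_zero hr.ne'), h.scaling r hr A hA]

/-- Homogeneity replaces a null-boundary condition: `t • U` has measure `t ^ (-α)` times that of
`U`, and `t` tends to `1` from below. -/
theorem realMeasure_le_of_subset_smul (h : IsMRV F α μ) {C U : Set (Fin d → ℝ)}
    (hU : MeasurableSet U) (hCU : ∀ t : ℝ, 0 < t → t < 1 → C ⊆ t • U) :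
    realMeasure μ C ≤ realMeasure μ U := by
  have hlim : Tendsto (fun t : ℝ => ENNReal.ofReal (t ^ (-α)) * realMeasure μ U) (𝓝[<] 1)
      (𝓝 (1 * realMeasure μ U)) := by
    refine ENNReal.Tendsto.mul_const ?_ (Or.inl one_ne_zero)
    have : Tendsto (fun t : ℝ => ENNReal.ofReal (t ^ (-α))) (𝓝[<] 1)
        (𝓝 (ENNReal.ofReal ((1 : ℝ) ^ (-α)))) :=
      (ENNReal.continuous_ofReal.tendsto _).comp
        ((Real.continuousAt_rpow_const 1 (-α) (Or.inl one_ne_zero)).tendsto.mono_left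
          nhdsWithin_le_nhds)
    simpa using this
  rw [one_mul] at hlim
  refine ge_of_tendsto hlim ?_
  have : Ioo (0 : ℝ) 1 ∈ 𝓝[<] (1 : ℝ) := Ioo_mem_nhdsLT one_pos
  filter_upwards [this] with t ht
  rw [← h.realMeasure_smul ht.1 hU]
  exact measure_mono (hCU t ht.1 ht.2)

/-- Convergence of the scaled law on open sets bounded away from the origin. -/
theorem tendsto_of_isOpen [IsFiniteMeasure F] (h : IsMRV F α μ) {U C : Set (Fin d → ℝ)}
    (hU : IsOpen U) (hC : IsClosed C) (hUC : U ⊆ C) (h0 : (0 : Fin d → ℝ) ∉ C)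
    (hCU : ∀ t : ℝ, 0 < t → t < 1 → C ⊆ t • U) :
    Tendsto (fun u : ℝ => (F {x | u < l1Norm x})⁻¹ * F {x | u⁻¹ • x ∈ U}) atTop
      (𝓝 (realMeasure μ U)) := by
  refine tendsto_order.2 ⟨fun a ha => h.eventually_lt_of_isOpen hU (fun h' => h0 (hUC h')) ha,
    fun a ha => ?_⟩
  filter_upwards [h.eventually_lt_of_isClosed hC h0
    ((h.realMeasure_le_of_subset_smul hU.measurableSet hCU).trans_lt ha)] with u hu
  refine lt_of_le_of_lt ?_ hu
  gcongr

theorem setOf_lt_l1Norm_subset {r : ℝ} (hr : 0 < r) {t : ℝ} (ht0 : 0 < t) (ht1 : t < 1) :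
    {x : Fin d → ℝ | r ≤ l1Norm x} ⊆ t • {x : Fin d → ℝ | r < l1Norm x} := by
  intro x hx
  rw [mem_smul_set_iff_inv_smul_mem₀ ht0.ne', mem_ofPred_eq, lt_l1Norm_inv_smul ht0]
  have : r ≤ l1Norm x := hx
  nlinarith

theorem smul_setOf_lt_l1Norm {r : ℝ} (hr : 0 < r) :
    r • {x : Fin d → ℝ | 1 < l1Norm x} = {x | r < l1Norm x} := by
  ext x
  rw [mem_smul_set_iff_inv_smul_mem₀ hr.ne', mem_ofPred_eq, lt_l1Norm_inv_smul hr, one_mul,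
    mem_ofPred_eq]

theorem tendsto_tail_aux [IsFiniteMeasure F] (h : IsMRV F α μ) {r : ℝ} (hr : 0 < r) :
    Tendsto (fun u : ℝ => (F {x | u < l1Norm x})⁻¹ * F {x | r * u < l1Norm x}) atTop
      (𝓝 (realMeasure μ {x | r < l1Norm x})) := by
  have := h.tendsto_of_isOpen (isOpen_lt (continuous_const (y := r)) continuous_l1Norm)
    (isClosed_le (continuous_const (y := r)) continuous_l1Norm) (fun x (hx : r < l1Norm x) => hx.le)
    (by simp [l1Norm_zero, hr]) (fun t ht0 ht1 => setOf_lt_l1Norm_subset hr ht0 ht1)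
  refine this.congr' ?_
  filter_upwards [eventually_gt_atTop 0] with u hu
  simp only [lt_l1Norm_inv_smul hu]

/-- For `r = 1` the convergent ratio is identically `1`; homogeneity gives the other radii. -/
theorem realMeasure_tail [IsFiniteMeasure F] (h : IsMRV F α μ) {r : ℝ} (hr : 0 < r) :
    realMeasure μ {x | r < l1Norm x} = ENNReal.ofReal (r ^ (-α)) := by
  have h1 : realMeasure μ {x | 1 < l1Norm x} = 1 := by
    refine tendsto_nhds_unique (h.tendsto_tail_aux one_pos) (tendsto_const_nhds.congr fun u => ?_)
    rw [one_mul, ENNReal.inv_mul_cancel (h.tail_ne_zero u) (measure_ne_top _ _)]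
  rw [← smul_setOf_lt_l1Norm hr, h.realMeasure_smul hr, h1, mul_one]
  exact (isOpen_lt continuous_const continuous_l1Norm).measurableSet

/-- The tail of the norm is regularly varying. -/
theorem tendsto_tail [IsFiniteMeasure F] (h : IsMRV F α μ) {r : ℝ} (hr : 0 < r) :
    Tendsto (fun u : ℝ => (F {x | u < l1Norm x})⁻¹ * F {x | r * u < l1Norm x}) atTop
      (𝓝 (ENNReal.ofReal (r ^ (-α)))) := by
  rw [← h.realMeasure_tail hr]
  exact h.tendsto_tail_aux hr

end IsMRV

/-! ### Monotone gauges. -/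

/-- A nonnegative, monotone, positively homogeneous, subadditive and continuous function. -/
structure IsMonotoneGauge {d : ℕ} (g : (Fin d → ℝ) → ℝ) : Prop where
  continuous : Continuous g
  nonneg : ∀ x, 0 ≤ g x
  mono : Monotone g
  add_le : ∀ x y, g (x + y) ≤ g x + g y
  smul : ∀ r : ℝ, 0 ≤ r → ∀ x, g (r • x) = r * g x

namespace IsMonotoneGauge

variable {d : ℕ} {g : (Fin d → ℝ) → ℝ} {c : Fin d → ℝ}

theorem map_zero (hg : IsMonotoneGauge g) : g 0 = 0 := by
  simpa using hg.smul 0 le_rfl 0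

/-- If `l1Norm x ≤ κ * (1 + v)` and `κ ≤ c j` for all `j`, then every coordinate of `x - v • c` is
at most `κ`, so its gauge is at most `κ * g 1 < 1`. The linear growth in `v` supplies the integrable
majorant. -/
theorem exists_lt_l1Norm (hg : IsMonotoneGauge g) (hc : ∀ j, 0 < c j) :
    ∃ κ : ℝ, 0 < κ ∧ ∀ v : ℝ, 0 ≤ v → ∀ x, 1 ≤ g (x - v • c) → κ * (1 + v) < l1Norm x := by
  -- `s` dominates every `(c j)⁻¹` and strictly dominates `g 1`.
  set s : ℝ := ∑ j, (c j)⁻¹ + g 1 + 1 with hs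
  have hsum : 0 ≤ ∑ j, (c j)⁻¹ := Finset.sum_nonneg fun j _ => (inv_pos.2 (hc j)).le
  have hg1 : 0 ≤ g 1 := hg.nonneg 1
  have hspos : 0 < s := by positivity
  have hκc : ∀ j, s⁻¹ ≤ c j := by
    intro j
    rw [inv_le_comm₀ hspos (hc j)]
    have := Finset.single_le_sum (f := fun j => (c j)⁻¹) (fun j _ => (inv_pos.2 (hc j)).le)
      (Finset.mem_univ j)
    linarith
  refine ⟨s⁻¹, inv_pos.2 hspos, fun v hv x hx => ?_⟩
  by_contra! hle
  have hxle : x - v • c ≤ s⁻¹ • (1 : Fin d → ℝ) := by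
    intro j
    have h1 : x j ≤ s⁻¹ * (1 + v) := (le_abs_self _).trans ((abs_le_l1Norm x j).trans hle)
    have h2 := mul_le_mul_of_nonneg_left (hκc j) hv
    simp only [Pi.sub_apply, Pi.smul_apply, smul_eq_mul, Pi.one_apply, mul_one]
    linarith
  have h1 := hx.trans (hg.mono hxle)
  rw [hg.smul _ (inv_pos.2 hspos).le, inv_mul_eq_div, le_div_iff₀ hspos] at h1
  linarith

theorem le_mul_l1Norm (hg : IsMonotoneGauge g) (x : Fin d → ℝ) : g x ≤ l1Norm x * g 1 := by
  rw [← hg.smul _ (l1Norm_nonneg x)]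
  refine hg.mono fun j => ?_
  simpa using (le_abs_self _).trans (abs_le_l1Norm x j)

theorem lt_map_inv_smul (hg : IsMonotoneGauge g) {u : ℝ} (hu : 0 < u) (x : Fin d → ℝ) :
    1 < g (u⁻¹ • x) ↔ u < g x := by
  rw [hg.smul _ (inv_pos.2 hu).le, inv_mul_eq_div, lt_div_iff₀ hu, one_mul]

theorem antitone_measure (hg : IsMonotoneGauge g) (hc : ∀ j, 0 < c j)
    (F : Measure (Fin d → ℝ)) (u : ℝ) : Antitone fun v : ℝ => F {x | u < g (x - v • c)} := by
  intro v w hvw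
  refine measure_mono fun x hx => lt_of_lt_of_le hx (hg.mono fun j => ?_)
  have := mul_le_mul_of_nonneg_right hvw (hc j).le
  simp only [Pi.sub_apply, Pi.smul_apply, smul_eq_mul]
  linarith

end IsMonotoneGauge

/-! ### Potter bounds and the integrated tail. -/

/-- A Potter type bound. -/
theorem exists_forall_le_rpow_mul {T : ℝ → ℝ} (hT : Antitone T) (hpos : ∀ u, 0 < T u) {α a : ℝ}
    (ha0 : 0 < a) (ha : a < α) (hlim : Tendsto (fun u => T (2 * u) / T u) atTop (𝓝 (2 ^ (-α)))) :
    ∃ u₀ : ℝ, 0 < u₀ ∧ ∀ u, u₀ ≤ u → ∀ s, 1 ≤ s → T (s * u) ≤ 2 ^ a * s ^ (-a) * T u := by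
  have hlt : (2 : ℝ) ^ (-α) < 2 ^ (-a) := Real.rpow_lt_rpow_of_exponent_lt one_lt_two (by linarith)
  obtain ⟨w, hw⟩ := eventually_atTop.1 (hlim.eventually (gt_mem_nhds hlt))
  have hstep : ∀ u, max w 1 ≤ u → T (2 * u) ≤ 2 ^ (-a) * T u := fun u hu =>
    ((div_lt_iff₀ (hpos u)).1 (hw u ((le_max_left _ _).trans hu))).le
  have hpow : ∀ k : ℕ, ∀ u, max w 1 ≤ u → T (2 ^ k * u) ≤ (2 ^ (-a)) ^ k * T u := by
    intro k
    induction k with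
    | zero => intro u _; simp
    | succ k ih =>
      intro u hu
      have hu1 : (1 : ℝ) ≤ u := (le_max_right _ _).trans hu
      have h1 := ih (2 * u) (by linarith)
      have h2 := hstep u hu
      calc T (2 ^ (k + 1) * u) = T (2 ^ k * (2 * u)) := by ring_nf
        _ ≤ (2 ^ (-a)) ^ k * T (2 * u) := h1
        _ ≤ (2 ^ (-a)) ^ k * (2 ^ (-a) * T u) := by gcongr
        _ = (2 ^ (-a)) ^ (k + 1) * T u := by ring
  refine ⟨max w 1, lt_of_lt_of_le one_pos (le_max_right _ _), fun u hu s hs => ?_⟩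
  -- Rounding `s` down to a power of `2` costs the factor `2 ^ a`.
  obtain ⟨k, hk1, hk2⟩ := exists_nat_pow_near hs one_lt_two
  have hu0 : (0 : ℝ) ≤ u := zero_le_one.trans ((le_max_right _ _).trans hu)
  refine (hT (mul_le_mul_of_nonneg_right hk1 hu0)).trans ((hpow k u hu).trans ?_)
  refine mul_le_mul_of_nonneg_right ?_ (hpos u).le
  have h3 : ((2 : ℝ) ^ (k + 1)) ^ (-a) ≤ s ^ (-a) :=
    Real.rpow_le_rpow_of_nonpos (by linarith) hk2.le (by linarith)
  refine le_trans (le_of_eq ?_) (mul_le_mul_of_nonneg_left h3 (by positivity))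
  rw [← Real.rpow_natCast, ← Real.rpow_natCast, ← Real.rpow_mul zero_le_two,
    ← Real.rpow_mul zero_le_two, ← Real.rpow_add zero_lt_two]
  push_cast
  ring_nf

theorem lintegral_Ioi_comp_mul {u : ℝ} (hu : 0 < u) {f : ℝ → ℝ≥0∞} (hf : Measurable f) :
    ∫⁻ v in Ioi (0 : ℝ), f v = ENNReal.ofReal u * ∫⁻ v in Ioi (0 : ℝ), f (u * v) := by
  rw [← lintegral_indicator measurableSet_Ioi, ← lintegral_indicator measurableSet_Ioi]
  conv_lhs => rw [← Real.smul_map_volume_mul_left hu.ne', abs_of_pos hu]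
  rw [lintegral_smul_measure, lintegral_map (hf.indicator measurableSet_Ioi)
    (measurable_const_mul u), smul_eq_mul]
  congr 1
  refine lintegral_congr fun v => ?_
  simp [indicator, hu]

namespace IsMRV

variable {d : ℕ} {F : Measure (Fin d → ℝ)} {α : ℝ} {μ : Measure (PuncturedExt d)}
  {g : (Fin d → ℝ) → ℝ} {c : Fin d → ℝ}

theorem tail_real_pos [IsFiniteMeasure F] (h : IsMRV F α μ) (u : ℝ) :
    0 < F.real {x | u < l1Norm x} :=
  ENNReal.toReal_pos (h.tail_ne_zero u) (measure_ne_top _ _)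

theorem antitone_tail_real [IsFiniteMeasure F] :
    Antitone fun u => F.real {x : Fin d → ℝ | u < l1Norm x} :=
  fun _ _ huv => measureReal_mono fun _ hx => lt_of_le_of_lt huv hx

theorem tendsto_tail_real [IsFiniteMeasure F] (h : IsMRV F α μ) {r : ℝ} (hr : 0 < r) :
    Tendsto (fun u : ℝ => F.real {x | r * u < l1Norm x} / F.real {x | u < l1Norm x}) atTop
      (𝓝 (r ^ (-α))) := by
  have := (ENNReal.tendsto_toReal ENNReal.ofReal_ne_top).comp (h.tendsto_tail hr)
  rw [ENNReal.toReal_ofReal (by positivity)] at this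
  refine this.congr fun u => ?_
  simp [Measure.real, ENNReal.toReal_mul, ENNReal.toReal_inv, div_eq_inv_mul]

theorem exists_tail_bound [IsFiniteMeasure F] (h : IsMRV F α μ) (hα : 1 < α) {κ : ℝ}
    (hκ : 0 < κ) : ∃ a C : ℝ, 1 < a ∧ 0 ≤ C ∧ ∀ᶠ u : ℝ in atTop, ∀ s, 1 ≤ s →
      F.real {x | κ * s * u < l1Norm x} ≤ C * s ^ (-a) * F.real {x | u < l1Norm x} := by
  obtain ⟨a, ha1, ha⟩ := exists_between hα
  obtain ⟨u₀, hu₀, hpot⟩ := exists_forall_le_rpow_mul antitone_tail_real h.tail_real_pos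
    (by linarith : 0 < a) ha (h.tendsto_tail_real two_pos)
  refine ⟨a, 2 ^ a * (κ ^ (-α) + 1), ha1, by positivity, ?_⟩
  have hev := (h.tendsto_tail_real hκ).eventually (gt_mem_nhds (lt_add_one (κ ^ (-α))))
  filter_upwards [hev, eventually_ge_atTop (u₀ / κ)] with u hu1 hu2 s hs
  rw [div_lt_iff₀ (h.tail_real_pos u)] at hu1
  rw [div_le_iff₀' hκ] at hu2
  have h1 := hpot (κ * u) hu2 s hs
  have hs' : 0 < s ^ (-a) := Real.rpow_pos_of_pos (by linarith) _
  calc F.real {x | κ * s * u < l1Norm x} = F.real {x | s * (κ * u) < l1Norm x} := by ring_nf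
    _ ≤ 2 ^ a * s ^ (-a) * F.real {x | κ * u < l1Norm x} := h1
    _ ≤ 2 ^ a * s ^ (-a) * ((κ ^ (-α) + 1) * F.real {x | u < l1Norm x}) := by gcongr
    _ = _ := by ring

theorem lintegral_bound_lt_top {a : ℝ} (ha : 1 < a) (C : ℝ) :
    ∫⁻ v in Ioi (0 : ℝ), ENNReal.ofReal (C * (1 + v) ^ (-a)) ≠ ∞ := by
  have h1 : IntegrableOn (fun t : ℝ => t ^ (-a)) (Ioi 1) :=
    integrableOn_Ioi_rpow_of_lt (by linarith) one_pos
  have h2 : IntegrableOn (fun v : ℝ => (1 + v) ^ (-a)) (Ioi 0) := by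
    have := (MeasureTheory.measurePreserving_add_left volume (1 : ℝ)).integrableOn_comp_preimage
      (MeasurableEquiv.addLeft (1 : ℝ)).measurableEmbedding (f := fun t : ℝ => t ^ (-a))
      (s := Ioi 1)
    simpa [Function.comp_def] using this.2 h1
  exact (h2.const_mul C).lintegral_lt_top.ne

/-- Limit of the integrated tail of the law of the claims along the direction `c`. -/
theorem tendsto_lintegral [IsFiniteMeasure F] (h : IsMRV F α μ) (hα : 1 < α)
    (hg : IsMonotoneGauge g) (hc : ∀ j, 0 < c j) :
    (∫⁻ v in Ioi (0 : ℝ), realMeasure μ {x | 1 < g (x - v • c)}) < ∞ ∧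
    Tendsto (fun u : ℝ => (ENNReal.ofReal u * F {x | u < l1Norm x})⁻¹ *
        ∫⁻ v in Ioi (0 : ℝ), F {x | u < g (x - v • c)}) atTop
      (𝓝 (∫⁻ v in Ioi (0 : ℝ), realMeasure μ {x | 1 < g (x - v • c)})) := by
  obtain ⟨κ, hκ, hκb⟩ := hg.exists_lt_l1Norm hc
  have hcont : ∀ v : ℝ, Continuous fun x => g (x - v • c) := fun v =>
    hg.continuous.comp (continuous_id.sub continuous_const)
  constructor
  · refine lt_of_le_of_lt (setLIntegral_mono' measurableSet_Ioi fun v hv => ?_)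
      (lintegral_bound_lt_top hα (κ ^ (-α))).lt_top
    have hv : (0 : ℝ) < v := hv
    refine (measure_mono (t := {x | κ * (1 + v) < l1Norm x}) fun x hx =>
      hκb v hv.le x (le_of_lt hx)).trans ?_
    rw [h.realMeasure_tail (by positivity), Real.mul_rpow hκ.le (by positivity)]
  · obtain ⟨a, C, ha, hC, hev⟩ := h.exists_tail_bound hα hκ
    have hmain : Tendsto (fun u : ℝ => ∫⁻ v in Ioi (0 : ℝ),
        (F {x | u < l1Norm x})⁻¹ * F {x | u < g (x - (u * v) • c)}) atTop
        (𝓝 (∫⁻ v in Ioi (0 : ℝ), realMeasure μ {x | 1 < g (x - v • c)})) := by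
      -- The majorant is integrable because `a > 1`, which is where `α > 1` enters.
      refine tendsto_lintegral_filter_of_dominated_convergence
        (fun v => ENNReal.ofReal (C * (1 + v) ^ (-a))) ?_ ?_ (lintegral_bound_lt_top ha C) ?_
      · exact Eventually.of_forall fun u => ((hg.antitone_measure hc F u).measurable.comp
          (measurable_const_mul u)).const_mul _
      · filter_upwards [hev, eventually_gt_atTop 0] with u hu hu0
        filter_upwards [self_mem_ae_restrict measurableSet_Ioi] with v hv
        have hv : (0 : ℝ) < v := hv
        rw [← ENNReal.div_eq_inv_mul]
        refine ENNReal.div_le_of_le_mul ?_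
        have h1 := hu (1 + v) (by linarith)
        have h2 : F {x | u < g (x - (u * v) • c)} ≤ F {x | κ * (1 + v) * u < l1Norm x} := by
          refine measure_mono fun x hx => ?_
          rw [mem_ofPred_eq, ← lt_l1Norm_inv_smul hu0]
          refine hκb v hv.le _ (le_of_lt ?_)
          rw [mem_ofPred_eq, ← hg.lt_map_inv_smul hu0, smul_sub, smul_smul,
            inv_mul_cancel_left₀ hu0.ne'] at hx
          exact hx
        refine h2.trans ?_
        rw [← ofReal_measureReal (measure_ne_top _ _), ← ofReal_measureReal (measure_ne_top _ _),
          ← ENNReal.ofReal_mul (by positivity)]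
        exact ENNReal.ofReal_le_ofReal h1
      · filter_upwards [self_mem_ae_restrict measurableSet_Ioi] with v hv
        have hv : (0 : ℝ) < v := hv
        have := h.tendsto_of_isOpen (isOpen_lt continuous_const (hcont v))
          (isClosed_le continuous_const (hcont v))
          (fun x (hx : 1 < g (x - v • c)) => hx.le) ?_ ?_
        · refine this.congr' ?_
          filter_upwards [eventually_gt_atTop 0] with u hu0
          congr 2
          ext x
          simp only [mem_ofPred_eq]
          rw [← hg.lt_map_inv_smul hu0, smul_sub,
            smul_smul, inv_mul_cancel_left₀ hu0.ne']
        · intro h0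
          have h1 := hκb v hv.le 0 h0
          rw [l1Norm_zero] at h1
          have : 0 < κ * (1 + v) := by positivity
          linarith
        · intro t ht0 ht1 x hx
          have hx : 1 ≤ g (x - v • c) := hx
          rw [mem_smul_set_iff_inv_smul_mem₀ ht0.ne', mem_ofPred_eq]
          have h1 : t⁻¹ • x - v • c = t⁻¹ • (x - (t * v) • c) := by
            rw [smul_sub, smul_smul, inv_mul_cancel_left₀ ht0.ne']
          have h2 : g (x - v • c) ≤ g (x - (t * v) • c) := by
            refine hg.mono fun j => ?_
            have : t * v * c j ≤ v * c j :=
              mul_le_mul_of_nonneg_right (by nlinarith) (hc j).le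
            simp only [Pi.sub_apply, Pi.smul_apply, smul_eq_mul]
            linarith
          rw [h1, hg.lt_map_inv_smul ht0]
          linarith
    refine hmain.congr' ?_
    filter_upwards [eventually_gt_atTop 0] with u hu0
    have hu1 : ENNReal.ofReal u ≠ 0 := by simpa using hu0
    rw [lintegral_const_mul' _ _ (ENNReal.inv_ne_top.2 (h.tail_ne_zero u)),
      lintegral_Ioi_comp_mul hu0 (hg.antitone_measure hc F u).measurable,
      ENNReal.mul_inv (Or.inl hu1) (Or.inl ENNReal.ofReal_ne_top), mul_right_comm, ← mul_assoc,
      ENNReal.inv_mul_cancel hu1 ENNReal.ofReal_ne_top, one_mul, mul_comm]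

/-- With one level `w'` fixed, the Potter bound at `s = u / w'` makes the tail `O(u ^ (-a))` with `a
> 1`. -/
theorem tendsto_mul_tail_zero [IsFiniteMeasure F] (h : IsMRV F α μ) (hα : 1 < α) :
    Tendsto (fun u : ℝ => u * F.real {x | u < l1Norm x}) atTop (𝓝 0) := by
  obtain ⟨a, C, ha, hC, hev⟩ := h.exists_tail_bound hα one_pos
  obtain ⟨w, hw⟩ := eventually_atTop.1 hev
  set w' := max w 1
  have hw' := hw w' (le_max_left _ _)
  have hw1 : 1 ≤ w' := le_max_right _ _
  have hw0 : 0 < w' := by linarith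
  have hlim : Tendsto (fun s : ℝ => w' * C * F.real {x : Fin d → ℝ | w' < l1Norm x} *
      s ^ (-(a - 1))) atTop (𝓝 0) := by
    simpa using (tendsto_rpow_neg_atTop (by linarith : 0 < a - 1)).const_mul
      (w' * C * F.real {x : Fin d → ℝ | w' < l1Norm x})
  have hlim2 := hlim.comp (tendsto_id.atTop_div_const hw0)
  refine squeeze_zero' ?_ ?_ hlim2
  · filter_upwards [eventually_ge_atTop 0] with u hu
    positivity
  · filter_upwards [eventually_ge_atTop w'] with u hu
    have hs : 1 ≤ u / w' := (one_le_div hw0).2 hu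
    have hs0 : 0 < u / w' := by linarith
    have h1 := hw' _ hs
    have h2 : 1 * (u / w') * w' = u := by field_simp
    rw [h2] at h1
    have h3 : (u / w') ^ (-(a - 1)) = (u / w') * (u / w') ^ (-a) := by
      rw [show -(a - 1) = 1 + -a by ring, Real.rpow_add hs0, Real.rpow_one]
    simp only [Function.comp, id, h3]
    calc u * F.real {x | u < l1Norm x} ≤ u * (C * (u / w') ^ (-a) *
          F.real {x | w' < l1Norm x}) := by gcongr; linarith
      _ = _ := by field_simp

/-- The law of a shifted claim is negligible with respect to the integrated tail. -/
theorem tendsto_shift_div [IsFiniteMeasure F] (h : IsMRV F α μ)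
    (hg : IsMonotoneGauge g) (z : Fin d → ℝ) :
    Tendsto (fun u : ℝ => F.real {x | u < g (x + z)} / (u * F.real {x | u < l1Norm x})) atTop
      (𝓝 0) := by
  -- For `u ≥ 2 * g z`, `u < g (x + z)` forces `g x > u / 2`, hence `l1Norm x > r * u`; the
  -- remaining factor `u⁻¹` tends to `0`.
  set r : ℝ := (2 * (g 1 + 1))⁻¹ with hr
  have hg1 := hg.nonneg 1
  have hr0 : 0 < r := by positivity
  have hlim := (h.tendsto_tail_real hr0).mul tendsto_inv_atTop_zero
  rw [mul_zero] at hlim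
  refine squeeze_zero' ?_ ?_ hlim
  · filter_upwards [eventually_ge_atTop 0] with u hu
    positivity
  · filter_upwards [eventually_gt_atTop 0, eventually_ge_atTop (2 * g z)] with u hu0 hu
    rw [div_mul_eq_div_div_swap, ← div_eq_mul_inv]
    refine mul_le_mul_of_nonneg_right (div_le_div_of_nonneg_right
      (measureReal_mono fun x hx => ?_) measureReal_nonneg) (inv_pos.2 hu0).le
    have hx : u < g (x + z) := hx
    have h1 := hg.add_le x z
    have h2 := hg.le_mul_l1Norm x
    have h3 := l1Norm_nonneg x
    rw [mem_ofPred_eq, hr, inv_mul_eq_div, div_lt_iff₀ (by positivity)]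
    nlinarith

end IsMRV

/-! ### The renewal type inequality. -/

/-- Upper bound in a renewal type inequality with respect to a regularly varying function. -/
theorem eventually_le_of_renewal_inequality {m D : ℝ → ℝ} {β I : ℝ} (hI : 0 ≤ I)
    (hm0 : ∀ u, 0 ≤ m u) (hm1 : ∀ u, m u ≤ 1) (hm : Tendsto m atTop (𝓝 0))
    (hD : ∀ u, 0 < u → 0 < D u)
    (hDlim : ∀ r : ℝ, 0 < r → Tendsto (fun u => D (r * u) / D u) atTop (𝓝 (r ^ (-β))))
    (hDlow : ∀ a b : ℝ, 0 < a → ∃ e, 0 < e ∧ ∀ u ∈ Icc a b, e ≤ D u)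
    (hrec : ∀ η : ℝ, 0 < η → ∃ G : ℝ → ℝ, (∀ᶠ u in atTop, G u ≤ (I + η) * D u) ∧
      ∀ δ ∈ Ioo (0 : ℝ) 1, ∀ᶠ u in atTop,
        m u ≤ G ((1 - δ) * u) + η * m ((1 - δ) * u) + G (δ * u) * m (δ * u))
    {ε : ℝ} (hε : 0 < ε) : ∀ᶠ u in atTop, m u ≤ (I + ε) * D u := by
  have hscale : ∀ r : ℝ, 0 < r → Tendsto (fun u : ℝ => r * u) atTop atTop := fun r hr =>
    tendsto_id.const_mul_atTop hr
  have hbound : ∃ C : ℝ, 0 ≤ C ∧ ∀ᶠ u in atTop, m u ≤ C * D u := by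
    -- Eventually `D (u / 2) ≤ K * D u`, so `η * K = 1 / 2` makes the halving recursion a
    -- contraction.
    set K : ℝ := (1 / 2 : ℝ) ^ (-β) + 1 with hK
    have hKpos : 0 < K := by positivity
    set η : ℝ := 1 / (2 * K) with hη
    have hηpos : 0 < η := by positivity
    obtain ⟨G, hG, hGrec⟩ := hrec η hηpos
    have hhalf : (0 : ℝ) < 1 / 2 := by norm_num
    have hstep : ∀ᶠ u in atTop, m u ≤ 2 * (I + η) * K * D u + η * m (u / 2) ∧
        D (u / 2) ≤ K * D u := by
      filter_upwards [hGrec (1 / 2) (by norm_num), (hscale _ hhalf).eventually hG,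
        (hDlim _ hhalf).eventually (gt_mem_nhds (lt_add_one _)), eventually_gt_atTop 0]
        with u h1 h2 h3 hu
      have hDu := hD u hu
      rw [div_lt_iff₀ hDu] at h3
      rw [show (1 : ℝ) - 1 / 2 = 1 / 2 by norm_num] at h1
      have e : (1 / 2 : ℝ) * u = u / 2 := by ring
      rw [e] at h1 h2 h3
      have h5 : G (u / 2) * m (u / 2) ≤ (I + η) * D (u / 2) := by
        have h6 := mul_le_mul_of_nonneg_right h2 (hm0 (u / 2))
        have h7 : 0 ≤ (I + η) * D (u / 2) :=
          mul_nonneg (by linarith) (hD _ (by linarith)).le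
        have h8 := mul_le_mul_of_nonneg_left (hm1 (u / 2)) h7
        linarith
      have h9 : (I + η) * D (u / 2) ≤ (I + η) * (K * D u) :=
        mul_le_mul_of_nonneg_left h3.le (by linarith)
      exact ⟨by linarith, h3.le⟩
    obtain ⟨w, hw⟩ := eventually_atTop.1 hstep
    set w' := max w 1
    have hw1 : (1 : ℝ) ≤ w' := le_max_right _ _
    obtain ⟨e, he, hlow⟩ := hDlow (w' / 2) w' (by linarith)
    -- Half of `C * D u` pays for the source term, half for the recursive term; `1 / e` covers the
    -- initial interval, where `m ≤ 1`.
    set C : ℝ := max (4 * (I + η) * K) (1 / e) with hC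
    have hC0 : 0 ≤ C := (by positivity : (0 : ℝ) ≤ 1 / e).trans (le_max_right _ _)
    have hind : ∀ n : ℕ, ∀ u ∈ Icc (w' / 2) (2 ^ n * w'), m u ≤ C * D u := by
      intro n
      have hbase : ∀ u ∈ Icc (w' / 2) w', m u ≤ C * D u := by
        intro u hu
        have h2 : 1 ≤ C * e := (div_le_iff₀ he).1 (le_max_right _ _)
        have h3 := mul_le_mul_of_nonneg_left (hlow u hu) hC0
        linarith [hm1 u]
      induction n with
      | zero => simpa using hbase
      | succ n ih =>
        intro u hu
        rcases le_total u w' with h | h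
        · exact hbase u ⟨hu.1, h⟩
        · have h1 := ih (u / 2) ⟨by linarith, by
            have := hu.2
            rw [pow_succ] at this
            linarith⟩
          obtain ⟨h2, h3⟩ := hw u ((le_max_left _ _).trans h)
          have hDu := hD u (by linarith)
          have h4 : η * m (u / 2) ≤ η * (C * (K * D u)) :=
            mul_le_mul_of_nonneg_left (h1.trans (mul_le_mul_of_nonneg_left h3 hC0)) hηpos.le
          have h5 : η * (C * (K * D u)) = C / 2 * D u := by
            rw [hη]
            field_simp
          have h6 : 4 * (I + η) * K * D u ≤ C * D u :=
            mul_le_mul_of_nonneg_right (le_max_left _ _) hDu.le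
          linarith
    refine ⟨C, hC0, ?_⟩
    filter_upwards [eventually_ge_atTop w'] with u hu
    obtain ⟨n, hn⟩ := pow_unbounded_of_one_lt (u / w') one_lt_two
    rw [div_lt_iff₀ (by linarith)] at hn
    exact hind n u ⟨by linarith, hn.le⟩
  obtain ⟨C, hC0, hC⟩ := hbound
  -- Now `η * m` costs at most `η * C * D`, for a total of `I + ε / 2`; the other `ε / 2` absorbs
  -- the rescaling by `1 - δ`.
  set η : ℝ := ε / (2 * (1 + C)) with hη
  have hηpos : 0 < η := by positivity
  have hηε : I + η + η * C = I + ε / 2 := by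
    rw [hη]
    field_simp
    ring
  obtain ⟨G, hG, hGrec⟩ := hrec η hηpos
  obtain ⟨δ, hδ, hδε⟩ : ∃ δ ∈ Ioo (0 : ℝ) 1, (I + ε / 2) * (1 - δ) ^ (-β) < I + ε := by
    have h1 : Tendsto (fun δ : ℝ => (I + ε / 2) * (1 - δ) ^ (-β)) (𝓝[>] 0)
        (𝓝 ((I + ε / 2) * (1 - 0) ^ (-β))) := by
      refine Tendsto.const_mul _ ?_
      have h2 : ContinuousAt (fun δ : ℝ => (1 - δ) ^ (-β)) 0 :=
        ContinuousAt.rpow_const (by fun_prop) (Or.inl (by norm_num))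
      exact h2.tendsto.mono_left nhdsWithin_le_nhds
    have h3 : (I + ε / 2) * (1 - 0) ^ (-β) < I + ε := by
      rw [sub_zero, Real.one_rpow]
      linarith
    obtain ⟨δ, h4, h5⟩ := ((h1.eventually (gt_mem_nhds h3)).and
      (Ioo_mem_nhdsGT (one_pos (α := ℝ)))).exists
    exact ⟨δ, h5, h4⟩
  have hlim : Tendsto (fun u => (I + ε / 2) * (D ((1 - δ) * u) / D u) +
      (I + η) * (D (δ * u) / D u) * m (δ * u)) atTop
      (𝓝 ((I + ε / 2) * (1 - δ) ^ (-β) + (I + η) * δ ^ (-β) * 0)) :=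
    ((hDlim _ (by linarith [hδ.2])).const_mul _).add
      (((hDlim _ hδ.1).const_mul _).mul (hm.comp (hscale _ hδ.1)))
  rw [mul_zero, add_zero] at hlim
  have hδ' : 0 < 1 - δ := by linarith [hδ.2]
  filter_upwards [hlim.eventually (gt_mem_nhds hδε), hGrec δ hδ, (hscale _ hδ').eventually hG,
    (hscale _ hδ.1).eventually hG, (hscale _ hδ').eventually hC, eventually_gt_atTop 0]
    with u h1 h2 h3 h4 h5 hu
  have hDu := hD u hu
  have h6 := mul_lt_mul_of_pos_right h1 hDu
  have h7 : ((I + ε / 2) * (D ((1 - δ) * u) / D u) +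
      (I + η) * (D (δ * u) / D u) * m (δ * u)) * D u =
      (I + ε / 2) * D ((1 - δ) * u) + (I + η) * D (δ * u) * m (δ * u) := by
    field_simp
  rw [h7] at h6
  have h8 := mul_le_mul_of_nonneg_right h4 (hm0 (δ * u))
  have h9 := mul_le_mul_of_nonneg_left h5 hηpos.le
  linear_combination h2 + h3 + h8 + h9 + h6.le + D ((1 - δ) * u) * hηε

/-! ### Comparison of sums and integrals of antitone functions. -/

section SumIntegral

variable {f : ℝ → ℝ≥0∞} {a : ℝ}

theorem lintegral_Ioi_eq_tsum (ha : 0 < a) (b : ℝ) :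
    ∫⁻ v in Ioi b, f v = ∑' n : ℕ, ∫⁻ v in Ioc (b + n * a) (b + (n + 1 : ℕ) * a), f v := by
  have hmono : Monotone fun n : ℕ => b + n * a := fun m n hmn => by
    have : (m : ℝ) * a ≤ n * a := by gcongr
    linarith
  have htop : Tendsto (fun n : ℕ => b + n * a) atTop atTop :=
    tendsto_atTop_add_const_left _ _ (tendsto_natCast_atTop_atTop.atTop_mul_const ha)
  have hunion : ⋃ n : ℕ, Ioc (b + n * a) (b + (n + 1 : ℕ) * a) = Ioi b := by
    have := iUnion_Ioc_map_succ_eq_Ioi (f := fun n : ℕ => b + n * a)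
      (fun n => hmono bot_le) (not_bddAbove_of_tendsto_atTop htop)
    simpa using this
  rw [← hunion]
  exact lintegral_iUnion (fun n => measurableSet_Ioc) hmono.pairwise_disjoint_on_Ioc_succ _

theorem mul_tsum_le_lintegral (hf : Antitone f) (ha : 0 < a) {k : ℝ} (hk : 0 ≤ k) :
    ENNReal.ofReal a * ∑' n : ℕ, f (n * a - k) ≤
      (∫⁻ v in Ioi (0 : ℝ), f v) + ENNReal.ofReal (k + a) * f (-k - a) := by
  have h1 : ENNReal.ofReal a * ∑' n : ℕ, f (n * a - k) ≤ ∫⁻ v in Ioi (-k - a), f v := by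
    rw [lintegral_Ioi_eq_tsum ha, ← ENNReal.tsum_mul_left]
    refine ENNReal.tsum_le_tsum fun n => ?_
    calc ENNReal.ofReal a * f (n * a - k)
        = ∫⁻ _ in Ioc (-k - a + n * a) (-k - a + (n + 1 : ℕ) * a), f (n * a - k) := by
          rw [setLIntegral_const, Real.volume_Ioc, mul_comm]
          congr 2
          push_cast
          ring
      _ ≤ _ := by
          refine setLIntegral_mono' measurableSet_Ioc fun v hv => hf ?_
          have := hv.2
          push_cast at this
          linarith
  refine h1.trans ?_
  rw [← Ioc_union_Ioi_eq_Ioi (by linarith : -k - a ≤ 0), add_comm (∫⁻ v in _, f v)]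
  refine (lintegral_union_le _ _ _).trans (add_le_add ?_ le_rfl)
  calc ∫⁻ v in Ioc (-k - a) 0, f v ≤ ∫⁻ _ in Ioc (-k - a) 0, f (-k - a) :=
        setLIntegral_mono' measurableSet_Ioc fun v hv => hf hv.1.le
    _ = _ := by
        rw [setLIntegral_const, Real.volume_Ioc, mul_comm]
        congr 2
        ring

theorem lintegral_le_mul_tsum (hf : Antitone f) (ha : 0 < a) {k : ℝ} (hk : 0 ≤ k) :
    ∫⁻ v in Ioi (0 : ℝ), f v ≤
      ENNReal.ofReal a * ∑' n : ℕ, f (k + n * a) + ENNReal.ofReal k * f 0 := by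
  rw [← Ioc_union_Ioi_eq_Ioi hk, add_comm]
  refine (lintegral_union_le _ _ _).trans (add_le_add ?_ ?_)
  · calc ∫⁻ v in Ioc 0 k, f v ≤ ∫⁻ _ in Ioc 0 k, f 0 :=
          setLIntegral_mono' measurableSet_Ioc fun v hv => hf hv.1.le
      _ = _ := by rw [setLIntegral_const, Real.volume_Ioc, mul_comm, sub_zero]
  · rw [lintegral_Ioi_eq_tsum ha, ← ENNReal.tsum_mul_left]
    refine ENNReal.tsum_le_tsum fun n => ?_
    calc _ ≤ ∫⁻ _ in Ioc (k + n * a) (k + (n + 1 : ℕ) * a), f (k + n * a) :=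
          setLIntegral_mono' measurableSet_Ioc fun v hv => hf hv.1.le
      _ = _ := by
          rw [setLIntegral_const, Real.volume_Ioc, mul_comm]
          congr 2
          push_cast
          ring

end SumIntegral

namespace IsMRV

variable {d : ℕ} {F : Measure (Fin d → ℝ)} {α : ℝ} {μ : Measure (PuncturedExt d)}
  {g : (Fin d → ℝ) → ℝ} {c : Fin d → ℝ}

theorem tendsto_lintegral_real [IsFiniteMeasure F] (h : IsMRV F α μ) (hα : 1 < α)
    (hg : IsMonotoneGauge g) (hc : ∀ j, 0 < c j) :
    Tendsto (fun u : ℝ => (∫⁻ v in Ioi (0 : ℝ), F {x | u < g (x - v • c)}).toReal /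
        (u * F.real {x | u < l1Norm x})) atTop
      (𝓝 (∫⁻ v in Ioi (0 : ℝ), realMeasure μ {x | 1 < g (x - v • c)}).toReal) := by
  obtain ⟨h1, h2⟩ := h.tendsto_lintegral hα hg hc
  refine ((ENNReal.tendsto_toReal h1.ne).comp h2).congr' ?_
  filter_upwards [eventually_gt_atTop 0] with u hu
  simp [Measure.real, ENNReal.toReal_mul, ENNReal.toReal_inv, div_eq_inv_mul,
    ENNReal.toReal_ofReal hu.le]

theorem eventually_lintegral_lt_top [IsFiniteMeasure F] (h : IsMRV F α μ) (hα : 1 < α)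
    (hg : IsMonotoneGauge g) (hc : ∀ j, 0 < c j) :
    ∀ᶠ u : ℝ in atTop, ∫⁻ v in Ioi (0 : ℝ), F {x | u < g (x - v • c)} < ∞ := by
  obtain ⟨h1, h2⟩ := h.tendsto_lintegral hα hg hc
  filter_upwards [h2.eventually (gt_mem_nhds h1)] with u hu
  by_contra hne
  rw [not_lt, top_le_iff] at hne
  rw [hne, ENNReal.mul_top] at hu
  · exact lt_irrefl _ hu
  · exact ENNReal.inv_ne_zero.2 (ENNReal.mul_ne_top ENNReal.ofReal_ne_top (measure_ne_top _ _))

/-- The boundary term of the integral comparison is the probability of a shifted claim, negligible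
by `tendsto_shift_div`. -/
theorem eventually_tsum_le [IsFiniteMeasure F] (h : IsMRV F α μ) (hα : 1 < α)
    (hg : IsMonotoneGauge g) (hc : ∀ j, 0 < c j) {a k K : ℝ} (ha : 0 < a) (hk : 0 ≤ k)
    (hK : (∫⁻ v in Ioi (0 : ℝ), realMeasure μ {x | 1 < g (x - v • c)}).toReal / a < K) :
    ∀ᶠ u : ℝ in atTop, ∑' n : ℕ, F {x | u < g (x - (n * a - k) • c)} ≤
      ENNReal.ofReal (K * (u * F.real {x | u < l1Norm x})) := by
  have hlim := ((h.tendsto_lintegral_real hα hg hc).add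
    ((h.tendsto_shift_div hg (-((-k - a) • c))).const_mul (k + a))).div_const a
  rw [mul_zero, add_zero] at hlim
  filter_upwards [hlim.eventually (gt_mem_nhds hK), eventually_gt_atTop 0,
    h.eventually_lintegral_lt_top hα hg hc] with u h1 hu hfin
  have hD : 0 < u * F.real {x | u < l1Norm x} := mul_pos hu (h.tail_real_pos u)
  have h2 := mul_tsum_le_lintegral (hg.antitone_measure hc F u) ha hk
  rw [mul_comm, ← ENNReal.le_div_iff_mul_le (Or.inl (by simpa using ha))
    (Or.inl ENNReal.ofReal_ne_top)] at h2
  refine h2.trans ?_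
  rw [← ENNReal.ofReal_toReal hfin.ne, ← ofReal_measureReal (measure_ne_top _ _),
    ← ENNReal.ofReal_mul (by linarith), ← ENNReal.ofReal_add ENNReal.toReal_nonneg (by positivity),
    ← ENNReal.ofReal_div_of_pos ha]
  refine ENNReal.ofReal_le_ofReal ?_
  have h3 := mul_lt_mul_of_pos_right h1 hD
  refine le_trans (le_of_eq ?_) h3.le
  have hT := (h.tail_real_pos u).ne'
  simp only [sub_eq_add_neg]
  field_simp

theorem eventually_le_tsum [IsFiniteMeasure F] (h : IsMRV F α μ) (hα : 1 < α)
    (hg : IsMonotoneGauge g) (hc : ∀ j, 0 < c j) {a k K : ℝ} (ha : 0 < a) (hk : 0 ≤ k)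
    (hK : K < (∫⁻ v in Ioi (0 : ℝ), realMeasure μ {x | 1 < g (x - v • c)}).toReal / a) :
    ∀ᶠ u : ℝ in atTop, ENNReal.ofReal (K * (u * F.real {x | u < l1Norm x})) ≤
      ∑' n : ℕ, F {x | u < g (x - (k + n * a) • c)} := by
  have hlim := ((h.tendsto_lintegral_real hα hg hc).sub
    ((h.tendsto_shift_div hg (-((0 : ℝ) • c))).const_mul k)).div_const a
  rw [mul_zero, sub_zero] at hlim
  filter_upwards [hlim.eventually (lt_mem_nhds hK), eventually_gt_atTop 0,
    h.eventually_lintegral_lt_top hα hg hc] with u h1 hu hfin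
  have hD : 0 < u * F.real {x | u < l1Norm x} := mul_pos hu (h.tail_real_pos u)
  have h2 := lintegral_le_mul_tsum (hg.antitone_measure hc F u) ha hk
  rw [← tsub_le_iff_right] at h2
  refine le_trans ?_ (ENNReal.div_le_of_le_mul' h2)
  rw [← ENNReal.ofReal_toReal hfin.ne, ← ofReal_measureReal (measure_ne_top _ _),
    ← ENNReal.ofReal_mul hk, ← ENNReal.ofReal_sub _ (by positivity),
    ← ENNReal.ofReal_div_of_pos ha]
  refine ENNReal.ofReal_le_ofReal ?_
  have h3 := mul_lt_mul_of_pos_right h1 hD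
  refine h3.le.trans (le_of_eq ?_)
  have hT := (h.tail_real_pos u).ne'
  simp only [sub_eq_add_neg]
  field_simp

end IsMRV

/-! ### Random walks: independence, stationarity, law of large numbers. -/

section RandomWalk

variable {Ω : Type*} {d : ℕ}

/-- The random walk with steps `Z`. -/
def walk (Z : ℕ → Ω → Fin d → ℝ) (n : ℕ) (ω : Ω) : Fin d → ℝ := ∑ i ∈ Finset.range n, Z i ω

/-- The event that the function `g` of the random walk ever exceeds the level `u`. -/
def exceedance (g : (Fin d → ℝ) → ℝ) (Z : ℕ → Ω → Fin d → ℝ) (u : ℝ) : Set Ω :=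
  {ω | ∃ n, u < g (walk Z n ω)}

/-- The information about the steps with indices in `s`. -/
abbrev stepsAlgebra (Z : ℕ → Ω → Fin d → ℝ) (s : Set ℕ) : MeasurableSpace Ω :=
  ⨆ i ∈ s, MeasurableSpace.comap (Z i) inferInstance

variable {Z : ℕ → Ω → Fin d → ℝ} {g : (Fin d → ℝ) → ℝ}

theorem measurable_step_stepsAlgebra {s : Set ℕ} {i : ℕ} (hi : i ∈ s) :
    Measurable[stepsAlgebra Z s] (Z i) := by
  rw [measurable_iff_comap_le]
  exact le_iSup₂_of_le i hi le_rfl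

theorem walk_succ (n : ℕ) (ω : Ω) : walk Z (n + 1) ω = walk Z n ω + Z n ω :=
  Finset.sum_range_succ _ _

theorem walk_add (m n : ℕ) (ω : Ω) :
    walk Z (m + n) ω = walk Z m ω + walk (fun i => Z (m + i)) n ω :=
  Finset.sum_range_add _ _ _

theorem measurable_walk_stepsAlgebra {s : Set ℕ} {m n : ℕ} (h : ∀ i < n, m + i ∈ s) :
    Measurable[stepsAlgebra Z s] (walk (fun i => Z (m + i)) n) := by
  unfold walk
  exact Finset.measurable_sum (m := stepsAlgebra Z s) _ fun i hi =>
    measurable_step_stepsAlgebra (h i (Finset.mem_range.1 hi))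

theorem measurable_walk_Iio {m n : ℕ} (h : m ≤ n) :
    Measurable[stepsAlgebra Z (Iio n)] (walk Z m) := by
  have := measurable_walk_stepsAlgebra (Z := Z) (s := Iio n) (m := 0) (n := m)
    (fun i hi => by simpa using hi.trans_le h)
  simpa using this

theorem measurableSet_exceedance_stepsAlgebra (hg : Continuous g) (n : ℕ) (u : ℝ) :
    MeasurableSet[stepsAlgebra Z (Ici n)] (exceedance g (fun i => Z (n + i)) u) := by
  have : exceedance g (fun i => Z (n + i)) u =
      ⋃ j, walk (fun i => Z (n + i)) j ⁻¹' {x | u < g x} := by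
    ext ω
    simp [exceedance]
  rw [this]
  exact MeasurableSet.iUnion fun j => measurable_walk_stepsAlgebra (fun i _ => by simp)
    (isOpen_lt continuous_const hg).measurableSet

variable [mΩ : MeasurableSpace Ω] {P : Measure Ω}

theorem stepsAlgebra_le (hZm : ∀ i, Measurable (Z i)) (s : Set ℕ) : stepsAlgebra Z s ≤ mΩ :=
  iSup₂_le fun i _ => (hZm i).comap_le

theorem measurable_walk (hZm : ∀ i, Measurable (Z i)) (n : ℕ) : Measurable (walk Z n) :=
  (measurable_walk_Iio le_rfl).mono (stepsAlgebra_le hZm _) le_rfl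

theorem measurableSet_exceedance (hg : Continuous g) (hZm : ∀ i, Measurable (Z i)) (u : ℝ) :
    MeasurableSet (exceedance g Z u) := by
  have := stepsAlgebra_le hZm _ _ (measurableSet_exceedance_stepsAlgebra (Z := Z) hg 0 u)
  simpa using this

/-- Independence of past and future at a fixed time suffices; no stopping times are needed, since
all decompositions run over deterministic `n`. -/
theorem measure_inter_of_stepsAlgebra (hZm : ∀ i, Measurable (Z i)) (hZ : iIndepFun Z P)
    {n : ℕ} {A B : Set Ω} (hA : MeasurableSet[stepsAlgebra Z (Iio n)] A)
    (hB : MeasurableSet[stepsAlgebra Z (Ici n)] B) : P (A ∩ B) = P A * P B := by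
  have hdisj : Disjoint (Iio n) (Ici n) :=
    Set.disjoint_left.2 fun i (h1 : i < n) (h2 : n ≤ i) => absurd h1 (not_lt.2 h2)
  have := indep_iSup_of_disjoint (fun i => (hZm i).comap_le) hZ hdisj
  exact (Indep_iff _ _ _).1 this A B hA hB

/-- The original and the shifted step sequence have the same product law on path space, and
exceedance is one fixed measurable set of paths. -/
theorem measure_exceedance_shift [IsProbabilityMeasure P] (hg : Continuous g)
    (hZm : ∀ i, Measurable (Z i)) (hZ : iIndepFun Z P)
    (hZid : ∀ i, IdentDistrib (Z i) (Z 0) P P) (n : ℕ) (u : ℝ) :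
    P (exceedance g (fun i => Z (n + i)) u) = P (exceedance g Z u) := by
  let B : Set (ℕ → Fin d → ℝ) := exceedance g (fun i z => z i) u
  have hB : MeasurableSet B := measurableSet_exceedance hg (fun i => measurable_pi_apply i) u
  have h1 : ∀ W : ℕ → Ω → Fin d → ℝ, (∀ i, Measurable (W i)) →
      P (exceedance g W u) = P.map (fun ω i => W i ω) B := fun W hW => by
    rw [Measure.map_apply (measurable_pi_lambda _ hW) hB]
    rfl
  rw [h1 _ hZm, h1 _ fun i => hZm (n + i), (iIndepFun_iff_map_fun_eq_infinitePi_map hZm).1 hZ,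
    (iIndepFun_iff_map_fun_eq_infinitePi_map fun i => hZm (n + i)).1
      (hZ.precomp (add_right_injective n))]
  congr 2
  funext i
  rw [(hZid (n + i)).map_eq, (hZid i).map_eq]

theorem exists_measure_compl_lt [IsFiniteMeasure P] {A : ℕ → Set Ω} (hmono : Monotone A)
    (hA : ∀ k, MeasurableSet (A k)) (hae : ∀ᵐ ω ∂P, ∃ k, ω ∈ A k) {η : ℝ≥0∞} (hη : 0 < η) :
    ∃ k, P (A k)ᶜ < η := by
  have h1 := tendsto_measure_iInter_atTop (μ := P) (s := fun k => (A k)ᶜ)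
    (fun k => (hA k).compl.nullMeasurableSet)
    (fun i j hij => compl_subset_compl.2 (hmono hij)) ⟨0, measure_ne_top _ _⟩
  have h2 : P (⋂ k, (A k)ᶜ) = 0 := by
    rw [← compl_iUnion]
    refine measure_mono_null ?_ (ae_iff.1 hae)
    intro ω hω
    simpa using hω
  rw [h2] at h1
  exact (h1.eventually (gt_mem_nhds hη)).exists

/-- The limit controls all large `n`; the intercept `k` absorbs the finitely many others. -/
theorem exists_forall_le_add_mul {t : ℕ → ℝ} {L b : ℝ}
    (h : Tendsto (fun n : ℕ => t n / n) atTop (𝓝 L)) (hL : L < b) :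
    ∃ k : ℕ, ∀ n : ℕ, t n ≤ k + n * b := by
  obtain ⟨N, hN⟩ := eventually_atTop.1 (h.eventually (gt_mem_nhds hL))
  obtain ⟨k, hk⟩ := exists_nat_ge (∑ n ∈ Finset.range (N + 1), |t n - n * b|)
  refine ⟨k, fun n => ?_⟩
  rcases Nat.lt_or_ge n (N + 1) with hn | hn
  · have := Finset.single_le_sum (f := fun n : ℕ => |t n - n * b|) (fun _ _ => abs_nonneg _)
      (Finset.mem_range.2 hn)
    have h2 := le_abs_self (t n - n * b)
    linarith
  · have hn0 : (0 : ℝ) < n := by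
      have : 0 < n := by omega
      exact_mod_cast this
    have := hN n (by omega)
    rw [div_lt_iff₀ hn0] at this
    have h0 : (0 : ℝ) ≤ k := Nat.cast_nonneg k
    linarith

theorem exists_forall_walk_le {c : Fin d → ℝ} (hc : ∀ j, 0 < c j) {s : ℕ → Fin d → ℝ} {L b : ℝ}
    (h : ∀ j, Tendsto (fun n : ℕ => s n j / n) atTop (𝓝 (L * c j))) (hL : L < b) :
    ∃ k : ℕ, ∀ n : ℕ, s n ≤ ((k : ℝ) + n * b) • c := by
  have h1 : ∀ j, ∃ k : ℕ, ∀ n : ℕ, s n j / c j ≤ k + n * b := by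
    intro j
    refine exists_forall_le_add_mul (L := L) ?_ hL
    have := (h j).div_const (c j)
    rw [mul_div_cancel_right₀ _ (hc j).ne'] at this
    refine this.congr fun n => ?_
    rw [div_right_comm]
  choose k hk using h1
  refine ⟨∑ j, k j, fun n j => ?_⟩
  have h2 := hk j n
  rw [div_le_iff₀ (hc j)] at h2
  have h3 : k j ≤ ∑ j, k j := Finset.single_le_sum (fun _ _ => Nat.zero_le _) (Finset.mem_univ j)
  have h4 : (k j : ℝ) ≤ (∑ j, k j : ℕ) := by exact_mod_cast h3
  refine h2.trans ?_
  rw [Pi.smul_apply, smul_eq_mul]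
  exact mul_le_mul_of_nonneg_right (by linarith) (hc j).le

theorem ae_tendsto_walk_div [IsProbabilityMeasure P] (hZ : iIndepFun Z P)
    (hZid : ∀ i, IdentDistrib (Z i) (Z 0) P P) (hint : ∀ j, Integrable (fun ω => Z 0 ω j) P) :
    ∀ᵐ ω ∂P, ∀ j, Tendsto (fun n : ℕ => walk Z n ω j / n) atTop (𝓝 (∫ ω, Z 0 ω j ∂P)) := by
  rw [ae_all_iff]
  intro j
  have := strong_law_ae_real (fun i ω => Z i ω j) (hint j)
    (fun i k hik => (hZ.indepFun hik).comp (measurable_pi_apply j) (measurable_pi_apply j))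
    (fun i => (hZid i).comp (measurable_pi_apply j))
  filter_upwards [this] with ω hω
  simpa [walk, Finset.sum_apply] using hω

end RandomWalk

/-! ### Bounds for the exceedance probability. -/

section Ruin

variable {Ω : Type*} [mΩ : MeasurableSpace Ω] {P : Measure Ω} [IsProbabilityMeasure P] {d : ℕ}
  {Z X : ℕ → Ω → Fin d → ℝ} {g : (Fin d → ℝ) → ℝ} {c : Fin d → ℝ} {F : Measure (Fin d → ℝ)}

/-- Almost every path lies below some line of slope `-a`, flatter than the drift; one intercept then
serves all paths outside a small event. -/
theorem exists_walk_le_line (hZm : ∀ i, Measurable (Z i)) (hc : ∀ j, 0 < c j)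
    (hlim : ∀ᵐ ω ∂P, ∀ j, Tendsto (fun n : ℕ => walk Z n ω j / n) atTop (𝓝 (-c j)))
    {a : ℝ} (ha : a < 1) {η : ℝ≥0∞} (hη : 0 < η) :
    ∃ k : ℕ, P {ω | ∀ n : ℕ, walk Z n ω ≤ ((k : ℝ) - n * a) • c}ᶜ < η := by
  refine exists_measure_compl_lt
    (A := fun k : ℕ => {ω | ∀ n : ℕ, walk Z n ω ≤ ((k : ℝ) - n * a) • c}) ?_ ?_ ?_ hη
  · intro k l hkl ω hω n j
    refine (hω n j).trans ?_
    have : (k : ℝ) ≤ l := by exact_mod_cast hkl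
    rw [Pi.smul_apply, Pi.smul_apply, smul_eq_mul, smul_eq_mul]
    exact mul_le_mul_of_nonneg_right (by linarith) (hc j).le
  · intro k
    simp only [ofPred_forall]
    exact MeasurableSet.iInter fun n => measurableSet_le (measurable_walk hZm n) measurable_const
  · filter_upwards [hlim] with ω hω
    obtain ⟨k, hk⟩ := exists_forall_walk_le hc (s := fun n => walk Z n ω) (L := -1) (b := -a)
      (fun j => by simpa using hω j) (by linarith)
    exact ⟨k, fun n => by simpa [sub_eq_add_neg] using hk n⟩

theorem exists_line_le_walk (hZm : ∀ i, Measurable (Z i)) (hc : ∀ j, 0 < c j)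
    (hlim : ∀ᵐ ω ∂P, ∀ j, Tendsto (fun n : ℕ => walk Z n ω j / n) atTop (𝓝 (-c j)))
    {a : ℝ} (ha : 1 < a) {η : ℝ≥0∞} (hη : 0 < η) :
    ∃ k : ℕ, P {ω | ∀ n : ℕ, -(((k : ℝ) + n * a) • c) ≤ walk Z n ω}ᶜ < η := by
  refine exists_measure_compl_lt
    (A := fun k : ℕ => {ω | ∀ n : ℕ, -(((k : ℝ) + n * a) • c) ≤ walk Z n ω}) ?_ ?_ ?_ hη
  · intro k l hkl ω hω n j
    refine le_trans ?_ (hω n j)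
    have : (k : ℝ) ≤ l := by exact_mod_cast hkl
    rw [Pi.neg_apply, Pi.neg_apply, Pi.smul_apply, Pi.smul_apply, smul_eq_mul, smul_eq_mul]
    exact neg_le_neg (mul_le_mul_of_nonneg_right (by linarith) (hc j).le)
  · intro k
    simp only [ofPred_forall]
    exact MeasurableSet.iInter fun n => measurableSet_le measurable_const (measurable_walk hZm n)
  · filter_upwards [hlim] with ω hω
    obtain ⟨k, hk⟩ := exists_forall_walk_le hc (s := fun n => -walk Z n ω) (L := 1) (b := a)
      (fun j => by simpa [neg_div] using (hω j).neg) ha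
    exact ⟨k, fun n => neg_le.1 (hk n)⟩

theorem tendsto_measure_exceedance_zero (hg : IsMonotoneGauge g) (hZm : ∀ i, Measurable (Z i))
    (hc : ∀ j, 0 < c j)
    (hlim : ∀ᵐ ω ∂P, ∀ j, Tendsto (fun n : ℕ => walk Z n ω j / n) atTop (𝓝 (-c j))) :
    Tendsto (fun u => P (exceedance g Z u)) atTop (𝓝 0) := by
  refine ENNReal.tendsto_nhds_zero.2 fun η hη => ?_
  obtain ⟨k, hk⟩ := exists_walk_le_line hZm hc hlim one_half_lt_one hη
  filter_upwards [eventually_ge_atTop (g ((k : ℝ) • c))] with u hu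
  refine (measure_mono ?_).trans hk.le
  rintro ω ⟨n, hn⟩ hω
  have h1 : walk Z n ω ≤ (k : ℝ) • c := (hω n).trans fun j => by
    rw [Pi.smul_apply, Pi.smul_apply, smul_eq_mul, smul_eq_mul]
    exact mul_le_mul_of_nonneg_right (by linarith [(Nat.cast_nonneg n : (0 : ℝ) ≤ n)]) (hc j).le
  exact absurd (hn.trans_le (hg.mono h1)) (not_lt.2 hu)

/-- Decomposition of the exceedance probability at the first time at which the random walk crosses
the line `n ↦ (k - n a) c`. -/
theorem measure_exceedance_le (hg : IsMonotoneGauge g) (hZm : ∀ i, Measurable (Z i))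
    (hZ : iIndepFun Z P) (hZid : ∀ i, IdentDistrib (Z i) (Z 0) P P)
    (hXm : ∀ i, Measurable (X i)) (hXF : ∀ i, P.map (X i) = F)
    (hle : ∀ i, ∀ᵐ ω ∂P, Z i ω ≤ X i ω) (hc : ∀ j, 0 < c j) {a : ℝ} (ha : 0 ≤ a) (k : ℕ)
    {u δ : ℝ} (hu : g ((k : ℝ) • c) ≤ u) :
    P (exceedance g Z u) ≤ ∑' n : ℕ, F {x | (1 - δ) * u < g (x - (n * a - k) • c)} +
      P {ω | ∀ n : ℕ, walk Z n ω ≤ ((k : ℝ) - n * a) • c}ᶜ * P (exceedance g Z ((1 - δ) * u)) +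
      (∑' n : ℕ, F {x | δ * u < g (x - (n * a - k) • c)}) * P (exceedance g Z (δ * u)) := by
  set W : ℕ → ℕ → Ω → Fin d → ℝ := fun n i => Z (n + i) with hW
  set good : ℕ → Set Ω := fun n => {ω | walk Z n ω ≤ ((k : ℝ) - n * a) • c} with hgood
  set A : ℕ → Set Ω := fun n => {ω | (∀ m ≤ n, ω ∈ good m) ∧ ω ∉ good (n + 1)} with hA
  have hgoodm : ∀ m n, m ≤ n → MeasurableSet[stepsAlgebra Z (Iio n)] (good m) := fun m n hmn =>
    measurable_walk_Iio hmn measurableSet_Iic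
  have hAm : ∀ n, MeasurableSet[stepsAlgebra Z (Iio (n + 1))] (A n) := by
    intro n
    have : A n = (⋂ m, ⋂ (_ : m ≤ n), good m) ∩ (good (n + 1))ᶜ := by
      ext ω
      simp [hA]
    rw [this]
    exact MeasurableSet.inter (MeasurableSet.iInter fun m => MeasurableSet.iInter fun hm =>
      hgoodm m _ (by omega)) (hgoodm _ _ le_rfl).compl
  have hSm : ∀ n (x : ℝ), MeasurableSet[stepsAlgebra Z (Iio n)] {ω | x < g (walk Z n ω)} :=
    fun n x => measurable_walk_Iio le_rfl
      (isOpen_lt continuous_const hg.continuous).measurableSet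
  have hEx : ∀ n x, P (exceedance g (W (n + 1)) x) = P (exceedance g Z x) := fun n x =>
    measure_exceedance_shift hg.continuous hZm hZ hZid (n + 1) x
  have hExm : ∀ n x, MeasurableSet[stepsAlgebra Z (Ici n)] (exceedance g (W n) x) := fun n x =>
    measurableSet_exceedance_stepsAlgebra hg.continuous n x
  have hcover : exceedance g Z u ⊆ ⋃ n, ((A n ∩ {ω | (1 - δ) * u < g (walk Z (n + 1) ω)}) ∪
      (A n ∩ exceedance g (W (n + 1)) ((1 - δ) * u))) ∪
      ((A n ∩ {ω | δ * u < g (walk Z (n + 1) ω)}) ∩ exceedance g (W (n + 1)) (δ * u)) := by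
    rintro ω ⟨N, hN⟩
    -- The line never exceeds `k • c`, whose gauge is at most `u`, so it has been crossed by time
    -- `N`. Keeping `n ≤ N` lets the remaining steps form a shifted walk.
    have hbad : ∃ n, ω ∉ good n ∧ n ≤ N := by
      refine ⟨N, fun h => ?_, le_rfl⟩
      have h1 : walk Z N ω ≤ (k : ℝ) • c := le_trans h fun j => by
        rw [Pi.smul_apply, Pi.smul_apply, smul_eq_mul, smul_eq_mul]
        exact mul_le_mul_of_nonneg_right
          (by linarith [mul_nonneg (Nat.cast_nonneg N : (0 : ℝ) ≤ N) ha]) (hc j).le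
      exact absurd (hN.trans_le (hg.mono h1)) (not_lt.2 hu)
    classical
    have hspec := Nat.find_spec hbad
    have hmin : ∀ m < Nat.find hbad, ω ∈ good m := by
      intro m hm
      by_contra hmem
      exact Nat.find_min hbad hm ⟨hmem, (hm.le.trans hspec.2)⟩
    have h0 : ω ∈ good 0 := by
      intro j
      simpa [walk] using mul_nonneg (Nat.cast_nonneg k : (0 : ℝ) ≤ k) (hc j).le
    obtain ⟨n, hn⟩ : ∃ n, Nat.find hbad = n + 1 :=
      Nat.exists_eq_succ_of_ne_zero fun h => hspec.1 (h ▸ h0)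
    rw [hn] at hspec hmin
    have hAn : ω ∈ A n := ⟨fun m hm => hmin m (by omega), hspec.1⟩
    obtain ⟨r, hr⟩ := Nat.exists_eq_add_of_le hspec.2
    have hsum : u < g (walk Z (n + 1) ω) + g (walk (W (n + 1)) r ω) := by
      refine lt_of_lt_of_le hN ?_
      rw [hr, walk_add]
      exact hg.add_le _ _
    refine mem_iUnion.2 ⟨n, ?_⟩
    by_cases h1 : (1 - δ) * u < g (walk Z (n + 1) ω)
    · exact Or.inl (Or.inl ⟨hAn, h1⟩)
    by_cases h2 : (1 - δ) * u < g (walk (W (n + 1)) r ω)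
    · exact Or.inl (Or.inr ⟨hAn, r, h2⟩)
    -- Both parts are at most `(1 - δ) * u` while their sum exceeds `u`, so each exceeds `δ * u`.
    exact Or.inr ⟨⟨hAn, show δ * u < _ by linarith⟩, r, by linarith⟩
  have hjump : ∀ n (x : ℝ), P (A n ∩ {ω | x < g (walk Z (n + 1) ω)}) ≤
      F {x' | x < g (x' - (n * a - k) • c)} := by
    intro n x
    have hmeas : MeasurableSet {x' : Fin d → ℝ | x < g (x' - ((n : ℝ) * a - k) • c)} :=
      (isOpen_lt continuous_const
        (hg.continuous.comp (continuous_id.sub continuous_const))).measurableSet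
    rw [← hXF n, Measure.map_apply (hXm n) hmeas]
    refine measure_mono_ae ?_
    filter_upwards [hle n] with ω hω hmem
    refine lt_of_lt_of_le hmem.2 (hg.mono ?_)
    rw [walk_succ]
    have h1 : walk Z n ω ≤ ((k : ℝ) - n * a) • c := hmem.1.1 n le_rfl
    have h2 : X n ω - ((n : ℝ) * a - k) • c = ((k : ℝ) - n * a) • c + X n ω := by
      rw [sub_eq_add_neg, ← neg_smul, neg_sub, add_comm]
    rw [h2]
    exact add_le_add h1 hω
  have hAdisj : Pairwise (Function.onFun Disjoint A) := by
    have : ∀ m n, m < n → Disjoint (A m) (A n) := fun m n hmn =>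
      Set.disjoint_left.2 fun ω h1 h2 => h1.2 (h2.1 (m + 1) (by omega))
    intro m n hmn
    rcases lt_or_gt_of_ne hmn with h | h
    · exact this m n h
    · exact (this n m h).symm
  have hAsum : ∑' n, P (A n) ≤ P {ω | ∀ n : ℕ, walk Z n ω ≤ ((k : ℝ) - n * a) • c}ᶜ := by
    rw [← measure_iUnion hAdisj fun n => stepsAlgebra_le hZm _ _ (hAm n)]
    refine measure_mono (iUnion_subset fun n ω hω hall => hω.2 (hall (n + 1)))
  calc P (exceedance g Z u) ≤ ∑' n, P _ := (measure_mono hcover).trans (measure_iUnion_le _)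
    _ ≤ ∑' n : ℕ, (F {x | (1 - δ) * u < g (x - (n * a - k) • c)} +
          P (A n) * P (exceedance g Z ((1 - δ) * u)) +
          F {x | δ * u < g (x - (n * a - k) • c)} * P (exceedance g Z (δ * u))) := by
        refine ENNReal.tsum_le_tsum fun n => ?_
        refine (measure_union_le _ _).trans (add_le_add
          ((measure_union_le _ _).trans (add_le_add (hjump n _) ?_)) ?_)
        · rw [measure_inter_of_stepsAlgebra hZm hZ (hAm n) (hExm _ _), hEx]
        · rw [measure_inter_of_stepsAlgebra hZm hZ
            (MeasurableSet.inter (hAm n) (hSm _ _)) (hExm _ _), hEx]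
          exact mul_le_mul_left (hjump n _) _
    _ = ∑' n : ℕ, F {x | (1 - δ) * u < g (x - (n * a - k) • c)} +
          (∑' n, P (A n)) * P (exceedance g Z ((1 - δ) * u)) +
          (∑' n : ℕ, F {x | δ * u < g (x - (n * a - k) • c)}) * P (exceedance g Z (δ * u)) := by
        rw [ENNReal.tsum_add, ENNReal.tsum_add, ENNReal.tsum_mul_right, ENNReal.tsum_mul_right]
    _ ≤ _ := by gcongr

/-- Lower bound for the exceedance probability in terms of the first large step. -/
theorem le_measure_exceedance (hg : IsMonotoneGauge g) (hZm : ∀ i, Measurable (Z i))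
    (hZ : iIndepFun Z P) {a : ℝ} (k : ℕ) (u : ℝ) :
    (1 - P {ω | ∀ n : ℕ, -(((k : ℝ) + n * a) • c) ≤ walk Z n ω}ᶜ -
        ∑' n : ℕ, P {ω | u < g (Z n ω - ((k : ℝ) + n * a) • c)}) *
      ∑' n : ℕ, P {ω | u < g (Z n ω - ((k : ℝ) + n * a) • c)} ≤ P (exceedance g Z u) := by
  set B : ℕ → Set Ω := fun n => {ω | u < g (Z n ω - ((k : ℝ) + n * a) • c)} with hB
  -- `C n` depends only on steps before `n`, hence is independent of `B n`; excluding earlier big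
  -- steps makes the sets `C n ∩ B n` disjoint.
  set C : ℕ → Set Ω := fun n => {ω | -(((k : ℝ) + n * a) • c) ≤ walk Z n ω} ∩ ⋂ m, ⋂ (_ : m < n),
    (B m)ᶜ with hC
  have hBm : ∀ n (s : Set ℕ), n ∈ s → MeasurableSet[stepsAlgebra Z s] (B n) := fun n s hn =>
    measurable_step_stepsAlgebra hn (isOpen_lt continuous_const
        (hg.continuous.comp (continuous_id.sub continuous_const))).measurableSet
  have hCm : ∀ n, MeasurableSet[stepsAlgebra Z (Iio n)] (C n) := fun n =>
    MeasurableSet.inter (measurable_walk_Iio le_rfl measurableSet_Ici)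
      (MeasurableSet.iInter fun m => MeasurableSet.iInter fun hm => (hBm m _ hm).compl)
  have hdisj : Pairwise (Function.onFun Disjoint fun n => C n ∩ B n) := by
    have : ∀ m n, m < n → Disjoint (C m ∩ B m) (C n ∩ B n) := fun m n hmn =>
      Set.disjoint_left.2 fun ω h1 h2 => by
        have := h2.1.2
        simp only [mem_iInter] at this
        exact this m hmn h1.2
    intro m n hmn
    rcases lt_or_gt_of_ne hmn with h | h
    · exact this m n h
    · exact (this n m h).symm
  have hsub : ⋃ n, C n ∩ B n ⊆ exceedance g Z u := by
    refine iUnion_subset fun n ω hω => ⟨n + 1, lt_of_lt_of_le hω.2 (hg.mono ?_)⟩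
    rw [walk_succ, sub_eq_neg_add]
    have : -(((k : ℝ) + n * a) • c) ≤ walk Z n ω := hω.1.1
    exact add_le_add this le_rfl
  have hCle : ∀ n, 1 - P {ω | ∀ n : ℕ, -(((k : ℝ) + n * a) • c) ≤ walk Z n ω}ᶜ - ∑' n, P (B n) ≤
      P (C n) := by
    intro n
    rw [tsub_tsub, tsub_le_iff_right, ← prob_add_prob_compl (μ := P)
      (stepsAlgebra_le hZm _ _ (hCm n))]
    refine add_le_add le_rfl ?_
    refine (measure_mono (t := {ω | ∀ n : ℕ, -(((k : ℝ) + n * a) • c) ≤ walk Z n ω}ᶜ ∪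
      ⋃ m, B m) fun ω hω => ?_).trans
      ((measure_union_le _ _).trans (add_le_add le_rfl (measure_iUnion_le _)))
    by_contra hcon
    simp only [mem_union, mem_iUnion, mem_compl_iff, not_or, not_not, not_exists] at hcon
    refine hω ⟨hcon.1 n, ?_⟩
    simp only [mem_iInter, mem_compl_iff]
    exact fun m _ => hcon.2 m
  rw [← ENNReal.tsum_mul_left]
  calc _ ≤ ∑' n, P (C n ∩ B n) := by
        refine ENNReal.tsum_le_tsum fun n => ?_
        rw [measure_inter_of_stepsAlgebra hZm hZ (hCm n) (hBm n _ (by simp))]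
        exact mul_le_mul_left (hCle n) _
    _ = P (⋃ n, C n ∩ B n) := (measure_iUnion hdisj fun n =>
        (stepsAlgebra_le hZm _ _ (hCm n)).inter
          (stepsAlgebra_le hZm univ _ (hBm n _ (mem_univ n)))).symm
    _ ≤ _ := measure_mono hsub

end Ruin

/-! ### Asymptotics of the exceedance probability. -/

section RuinAsymptotics

variable {Ω : Type*} [mΩ : MeasurableSpace Ω] {P : Measure Ω} [IsProbabilityMeasure P] {d : ℕ}
  {Z X W : ℕ → Ω → Fin d → ℝ} {g : (Fin d → ℝ) → ℝ} {c : Fin d → ℝ} {F : Measure (Fin d → ℝ)}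
  {α : ℝ} {μ : Measure (PuncturedExt d)}

/-- The renewal inequality is solved with `D u = u * F.real {x | u < l1Norm x}`, regularly varying
of index `-(α - 1)`. -/
theorem eventually_measure_exceedance_le [IsFiniteMeasure F] (h : IsMRV F α μ) (hα : 1 < α)
    (hg : IsMonotoneGauge g) (hc : ∀ j, 0 < c j) (hZm : ∀ i, Measurable (Z i))
    (hZ : iIndepFun Z P) (hZid : ∀ i, IdentDistrib (Z i) (Z 0) P P)
    (hXm : ∀ i, Measurable (X i)) (hXF : ∀ i, P.map (X i) = F)
    (hle : ∀ i, ∀ᵐ ω ∂P, Z i ω ≤ X i ω)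
    (hlim : ∀ᵐ ω ∂P, ∀ j, Tendsto (fun n : ℕ => walk Z n ω j / n) atTop (𝓝 (-c j)))
    {ε : ℝ} (hε : 0 < ε) :
    ∀ᶠ u : ℝ in atTop, P.real (exceedance g Z u) ≤
      ((∫⁻ v in Ioi (0 : ℝ), realMeasure μ {x | 1 < g (x - v • c)}).toReal + ε) *
        (u * F.real {x | u < l1Norm x}) := by
  set I := (∫⁻ v in Ioi (0 : ℝ), realMeasure μ {x | 1 < g (x - v • c)}).toReal with hI
  have hI0 : 0 ≤ I := ENNReal.toReal_nonneg
  refine eventually_le_of_renewal_inequality (m := fun u => P.real (exceedance g Z u))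
    (D := fun u => u * F.real {x | u < l1Norm x}) (β := α - 1) hI0
    (fun u => measureReal_nonneg) (fun u => measureReal_le_one) ?_ ?_ ?_ ?_ ?_ hε
  · exact (ENNReal.tendsto_toReal ENNReal.zero_ne_top).comp
      (tendsto_measure_exceedance_zero hg hZm hc hlim)
  · exact fun u hu => mul_pos hu (h.tail_real_pos u)
  · intro r hr
    have h1 := (h.tendsto_tail_real hr).const_mul r
    have h2 : r * r ^ (-α) = r ^ (-(α - 1)) := by
      rw [show -(α - 1) = 1 + -α by ring, Real.rpow_add hr, Real.rpow_one]
    rw [h2] at h1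
    refine h1.congr' ?_
    filter_upwards [eventually_gt_atTop 0] with u hu
    have := (h.tail_real_pos u).ne'
    field_simp
  · intro a b ha
    refine ⟨a * F.real {x | b < l1Norm x}, mul_pos ha (h.tail_real_pos b), fun u hu => ?_⟩
    exact mul_le_mul hu.1 (IsMRV.antitone_tail_real hu.2) measureReal_nonneg (ha.le.trans hu.1)
  · intro η hη
    -- This slope is below `1` and keeps `I / a < I + η`, also when `I = 0`.
    set a : ℝ := (I + η / 2) / (I + η) with ha
    have ha0 : 0 < a := by positivity
    have ha1 : a < 1 := (div_lt_one (by positivity)).2 (by linarith)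
    have hIa : I / a < I + η := by
      rw [div_lt_iff₀ ha0, ha, mul_div_cancel₀ _ (by positivity : I + η ≠ 0)]
      linarith
    obtain ⟨k, hk⟩ := exists_walk_le_line hZm hc hlim ha1 (ENNReal.ofReal_pos.2 hη)
    set G : ℝ → ℝ≥0∞ := fun u => ∑' n : ℕ, F {x | u < g (x - (n * a - k) • c)} with hG
    have hev : ∀ᶠ u : ℝ in atTop, G u ≤ ENNReal.ofReal ((I + η) * (u * F.real {x | u < l1Norm x})) :=
      h.eventually_tsum_le hα hg hc ha0 (Nat.cast_nonneg k) hIa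
    refine ⟨fun u => (G u).toReal, ?_, fun δ hδ => ?_⟩
    · filter_upwards [hev, eventually_ge_atTop 0] with u hu hu0
      exact ENNReal.toReal_le_of_le_ofReal (by positivity) hu
    · have hfin : ∀ᶠ u : ℝ in atTop, G u ≠ ∞ :=
        hev.mono fun u hu => (hu.trans_lt ENNReal.ofReal_lt_top).ne
      have hδ' : 0 < 1 - δ := by linarith [hδ.2]
      filter_upwards [(tendsto_id.const_mul_atTop hδ.1).eventually hfin,
        (tendsto_id.const_mul_atTop hδ').eventually hfin,
        eventually_ge_atTop (g ((k : ℝ) • c))] with u h1 h2 hu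
      simp only [id] at h1 h2
      have h3 := measure_exceedance_le hg hZm hZ hZid hXm hXF hle hc ha0.le k (δ := δ) hu
      have h4 : P (exceedance g Z u) ≤ G ((1 - δ) * u) +
          ENNReal.ofReal η * P (exceedance g Z ((1 - δ) * u)) +
          G (δ * u) * P (exceedance g Z (δ * u)) := h3.trans (by gcongr)
      have h5 : ENNReal.ofReal η * P (exceedance g Z ((1 - δ) * u)) ≠ ∞ :=
        ENNReal.mul_ne_top ENNReal.ofReal_ne_top (measure_ne_top _ _)
      have h6 : G (δ * u) * P (exceedance g Z (δ * u)) ≠ ∞ :=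
        ENNReal.mul_ne_top h1 (measure_ne_top _ _)
      have h7 := ENNReal.toReal_mono (ENNReal.add_ne_top.2 ⟨ENNReal.add_ne_top.2 ⟨h2, h5⟩, h6⟩) h4
      rwa [ENNReal.toReal_add (ENNReal.add_ne_top.2 ⟨h2, h5⟩) h6, ENNReal.toReal_add h2 h5,
        ENNReal.toReal_mul, ENNReal.toReal_mul, ENNReal.toReal_ofReal hη.le] at h7

theorem eventually_le_measure_exceedance [IsFiniteMeasure F] (h : IsMRV F α μ) (hα : 1 < α)
    (hg : IsMonotoneGauge g) (hc : ∀ j, 0 < c j) (hZm : ∀ i, Measurable (Z i))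
    (hZ : iIndepFun Z P) (hXm : ∀ i, Measurable (X i)) (hXF : ∀ i, P.map (X i) = F)
    (hle : ∀ i, ∀ᵐ ω ∂P, Z i ω ≤ X i ω) (hWm : ∀ i, Measurable (W i))
    (hWid : ∀ i, IdentDistrib (W i) (W 0) P P) (hXW : ∀ i, IndepFun (X i) (W i) P)
    (hZXW : ∀ i ω, Z i ω = X i ω - W i ω)
    (hlim : ∀ᵐ ω ∂P, ∀ j, Tendsto (fun n : ℕ => walk Z n ω j / n) atTop (𝓝 (-c j)))
    {K : ℝ} (hK : K < (∫⁻ v in Ioi (0 : ℝ), realMeasure μ {x | 1 < g (x - v • c)}).toReal) :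
    ∀ᶠ u : ℝ in atTop, K * (u * F.real {x | u < l1Norm x}) ≤ P.real (exceedance g Z u) := by
  set I := (∫⁻ v in Ioi (0 : ℝ), realMeasure μ {x | 1 < g (x - v • c)}).toReal with hI
  -- One factor `θ` each pays for the slope `1 / θ`, for the probability that the walk stays
  -- regular, and for replacing `Z n` by `X n`.
  obtain ⟨θ, hθ, hKθ⟩ : ∃ θ ∈ Ioo (0 : ℝ) 1, K < I * θ ^ 3 := by
    have h1 : Tendsto (fun θ : ℝ => I * θ ^ 3) (𝓝[<] 1) (𝓝 (I * 1 ^ 3)) :=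
      (Continuous.tendsto (by fun_prop) 1).mono_left nhdsWithin_le_nhds
    obtain ⟨θ, h2, h3⟩ := ((h1.eventually (lt_mem_nhds (by simpa using hK))).and
      (Ioo_mem_nhdsLT (one_pos (α := ℝ)))).exists
    exact ⟨θ, h3, h2⟩
  have hθ0 : 0 < θ := hθ.1
  set a : ℝ := 1 / θ with ha
  have ha1 : 1 < a := (one_lt_div hθ0).2 hθ.2
  have ha0 : 0 < a := by linarith
  set η : ℝ := (1 - θ) / 2 with hη
  have hη0 : 0 < η := by linarith [hθ.2]
  obtain ⟨k, hk⟩ := exists_line_le_walk hZm hc hlim ha1 (ENNReal.ofReal_pos.2 hη0)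
  obtain ⟨l, hl⟩ : ∃ l : ℕ, P {ω | W 0 ω ≤ (l : ℝ) • c}ᶜ < ENNReal.ofReal (1 - θ) := by
    refine exists_measure_compl_lt (A := fun l : ℕ => {ω | W 0 ω ≤ (l : ℝ) • c}) ?_ ?_ ?_
      (ENNReal.ofReal_pos.2 (by linarith [hθ.2]))
    · intro l l' hll ω hω j
      refine (hω j).trans ?_
      rw [Pi.smul_apply, Pi.smul_apply, smul_eq_mul, smul_eq_mul]
      exact mul_le_mul_of_nonneg_right (Nat.cast_le.2 hll) (hc j).le
    · exact fun l => measurableSet_le (hWm 0) measurable_const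
    · refine Eventually.of_forall fun ω => ?_
      obtain ⟨l, hl⟩ := exists_forall_walk_le hc (s := fun _ => W 0 ω) (L := 0) (b := 1)
        (fun j => by simpa using tendsto_const_div_atTop_nhds_zero_nat (W 0 ω j)) one_pos
      refine ⟨l, ?_⟩
      simpa using hl 0
  have hq : ENNReal.ofReal θ ≤ P {ω | W 0 ω ≤ (l : ℝ) • c} := by
    have h1 := prob_add_prob_compl (μ := P) (measurableSet_le (hWm 0) measurable_const :
      MeasurableSet {ω | W 0 ω ≤ (l : ℝ) • c})
    have h2 : ENNReal.ofReal θ = 1 - ENNReal.ofReal (1 - θ) := by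
      rw [← ENNReal.ofReal_one, ← ENNReal.ofReal_sub _ (by linarith [hθ.2])]
      congr 1
      ring
    rw [h2, tsub_le_iff_right, ← h1]
    gcongr
  have hmeas : ∀ (u : ℝ) (r : ℝ), MeasurableSet {x : Fin d → ℝ | u < g (x - r • c)} := fun u r =>
    (isOpen_lt continuous_const
      (hg.continuous.comp (continuous_id.sub continuous_const))).measurableSet
  have hBup : ∀ (u : ℝ) (n : ℕ), P {ω | u < g (Z n ω - ((k : ℝ) + n * a) • c)} ≤
      F {x | u < g (x - ((k : ℝ) + n * a) • c)} := by
    intro u n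
    rw [← hXF n, Measure.map_apply (hXm n) (hmeas _ _)]
    refine measure_mono_ae ?_
    filter_upwards [hle n] with ω hω hmem
    exact lt_of_lt_of_le hmem (hg.mono (sub_le_sub_right hω _))
  -- Since `W n` is independent of `X n` and at most `l • c` with probability at least `θ`,
  -- replacing `Z n` by `X n` only shifts the line by `l • c`.
  have hBlow : ∀ (u : ℝ) (n : ℕ), ENNReal.ofReal θ *
      F {x | u < g (x - ((k + l : ℕ) + n * a) • c)} ≤
      P {ω | u < g (Z n ω - ((k : ℝ) + n * a) • c)} := by
    intro u n
    have h1 : P (W n ⁻¹' Iic ((l : ℝ) • c)) = P {ω | W 0 ω ≤ (l : ℝ) • c} :=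
      (hWid n).measure_mem_eq measurableSet_Iic
    rw [← hXF n, Measure.map_apply (hXm n) (hmeas _ _), mul_comm]
    refine (mul_le_mul_right (hq.trans h1.ge) _).trans ?_
    rw [← (hXW n).measure_inter_preimage_eq_mul _ _ (hmeas u ((k + l : ℕ) + n * a))
      (measurableSet_Iic (a := (l : ℝ) • c))]
    refine measure_mono fun ω hω => ?_
    have h2 : u < g (X n ω - ((k + l : ℕ) + n * a) • c) := hω.1
    have h3 : W n ω ≤ (l : ℝ) • c := hω.2
    refine lt_of_lt_of_le h2 (hg.mono fun j => ?_)
    have h4 := h3 j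
    rw [hZXW]
    simp only [Pi.sub_apply, Pi.smul_apply, smul_eq_mul] at h4 ⊢
    push_cast
    linarith
  have hup : ∀ᶠ u : ℝ in atTop, ∑' n : ℕ, P {ω | u < g (Z n ω - ((k : ℝ) + n * a) • c)} ≤
      ENNReal.ofReal η := by
    have h1 := (h.tendsto_mul_tail_zero hα).const_mul (I + 1)
    rw [mul_zero] at h1
    have hIa : I / a < I + 1 := by
      have hI0 : 0 ≤ I := ENNReal.toReal_nonneg
      linarith [div_le_self hI0 ha1.le]
    filter_upwards [h1.eventually (gt_mem_nhds hη0),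
      h.eventually_tsum_le hα hg hc ha0 le_rfl hIa] with u h2 h3
    refine le_trans (ENNReal.tsum_le_tsum fun n => (hBup u n).trans ?_)
      (h3.trans (ENNReal.ofReal_le_ofReal h2.le))
    refine hg.antitone_measure hc F u ?_
    have : (0 : ℝ) ≤ k := Nat.cast_nonneg k
    linarith
  have hKa : K / θ ^ 2 < I / a := by
    rw [div_lt_iff₀ (by positivity), ha]
    field_simp
    linarith
  filter_upwards [hup, h.eventually_le_tsum hα hg hc ha0 (Nat.cast_nonneg (k + l)) hKa]
    with u h1 h2
  have h3 := le_measure_exceedance hg hZm hZ (c := c) (a := a) k u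
  have h4 : ENNReal.ofReal θ ≤ 1 - P {ω | ∀ n : ℕ, -(((k : ℝ) + n * a) • c) ≤ walk Z n ω}ᶜ -
      ∑' n : ℕ, P {ω | u < g (Z n ω - ((k : ℝ) + n * a) • c)} := by
    have h5 : ENNReal.ofReal θ = 1 - ENNReal.ofReal η - ENNReal.ofReal η := by
      rw [← ENNReal.ofReal_one, ← ENNReal.ofReal_sub _ hη0.le, ← ENNReal.ofReal_sub _ hη0.le]
      congr 1
      rw [hη]
      ring
    rw [h5]
    exact tsub_le_tsub (tsub_le_tsub le_rfl hk.le) h1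
  have h5 : ENNReal.ofReal θ * ENNReal.ofReal (K / θ ^ 2 * (u * F.real {x | u < l1Norm x})) ≤
      ∑' n : ℕ, P {ω | u < g (Z n ω - ((k : ℝ) + n * a) • c)} := by
    refine (mul_le_mul_right h2 _).trans ?_
    rw [← ENNReal.tsum_mul_left]
    exact ENNReal.tsum_le_tsum fun n => hBlow u n
  have h6 := (mul_le_mul' h4 h5).trans h3
  rw [← ENNReal.ofReal_mul hθ0.le, ← ENNReal.ofReal_mul hθ0.le,
    ENNReal.ofReal_le_iff_le_toReal (measure_ne_top _ _)] at h6
  refine le_trans (le_of_eq ?_) h6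
  field_simp

/-- Asymptotics of the exceedance probability of a heavy-tailed random walk. -/
theorem tendsto_measure_exceedance_div [IsFiniteMeasure F] (h : IsMRV F α μ) (hα : 1 < α)
    (hg : IsMonotoneGauge g) (hc : ∀ j, 0 < c j) (hZm : ∀ i, Measurable (Z i))
    (hZ : iIndepFun Z P) (hZid : ∀ i, IdentDistrib (Z i) (Z 0) P P)
    (hXm : ∀ i, Measurable (X i)) (hXF : ∀ i, P.map (X i) = F)
    (hle : ∀ i, ∀ᵐ ω ∂P, Z i ω ≤ X i ω) (hWm : ∀ i, Measurable (W i))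
    (hWid : ∀ i, IdentDistrib (W i) (W 0) P P) (hXW : ∀ i, IndepFun (X i) (W i) P)
    (hZXW : ∀ i ω, Z i ω = X i ω - W i ω)
    (hlim : ∀ᵐ ω ∂P, ∀ j, Tendsto (fun n : ℕ => walk Z n ω j / n) atTop (𝓝 (-c j))) :
    Tendsto (fun u : ℝ => P.real (exceedance g Z u) / (u * F.real {x | u < l1Norm x})) atTop
      (𝓝 (∫⁻ v in Ioi (0 : ℝ), realMeasure μ {x | 1 < g (x - v • c)}).toReal) := by
  refine tendsto_order.2 ⟨fun K hK => ?_, fun K hK => ?_⟩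
  · obtain ⟨K', hK1, hK2⟩ := exists_between hK
    filter_upwards [eventually_le_measure_exceedance h hα hg hc hZm hZ hXm hXF hle hWm hWid hXW
      hZXW hlim hK2, eventually_gt_atTop 0] with u hu hu0
    exact hK1.trans_le ((le_div_iff₀ (mul_pos hu0 (h.tail_real_pos u))).2 hu)
  · obtain ⟨K', hK1, hK2⟩ := exists_between hK
    filter_upwards [eventually_measure_exceedance_le h hα hg hc hZm hZ hZid hXm hXF hle hlim
      (sub_pos.2 hK1), eventually_gt_atTop 0] with u hu hu0
    rw [add_sub_cancel] at hu
    exact ((div_le_iff₀ (mul_pos hu0 (h.tail_real_pos u))).2 hu).trans_lt hK2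

end RuinAsymptotics

/-! ### The gauge of a ruin set. -/

namespace IsRuinSet

variable {d : ℕ} {L : Set (Fin d → ℝ)} {b : Fin d → ℝ}

theorem not_mem_of_nonneg (hL : IsRuinSet L) {x : Fin d → ℝ} (hx : 0 ≤ x) : x ∉ L := by
  intro h
  have h0 : (0 : Fin d → ℝ) ∈ L := hL.decreasing hx h
  have := hL.zero_mem_frontier
  rw [hL.isOpen.frontier_eq] at this
  exact this.2 h0

/-- All coordinates of `b` are positive, so points near `b` lie in the nonnegative orthant, which
misses `L`. -/
theorem compl_mem_nhds (hL : IsRuinSet L) (hb : ∀ j, 0 < b j) : {x | b - x ∈ Lᶜ} ∈ 𝓝 0 := by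
  have h1 : Tendsto (fun x : Fin d → ℝ => b - x) (𝓝 0) (𝓝 (b - 0)) :=
    (Continuous.tendsto (by fun_prop) 0)
  rw [sub_zero] at h1
  have h2 : Set.pi univ (fun _ => Ioi (0 : ℝ)) ∈ 𝓝 b :=
    set_pi_mem_nhds finite_univ fun j _ => Ioi_mem_nhds (hb j)
  filter_upwards [h1 h2] with x hx
  exact hL.not_mem_of_nonneg fun j => le_of_lt (hx j (mem_univ j))

theorem convex_preimage (hL : IsRuinSet L) : Convex ℝ {x | b - x ∈ Lᶜ} := by
  intro x hx y hy s t hs ht hst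
  have h1 := hL.convex_compl hx hy hs ht hst
  have h2 : b - (s • x + t • y) = s • (b - x) + t • (b - y) := by
    rw [smul_sub, smul_sub, sub_add_sub_comm, ← add_smul, hst, one_smul]
  rw [mem_ofPred_eq, h2]
  exact h1

/-- Monotonicity comes from `L` being decreasing, subadditivity from the convexity of `Lᶜ`, and
continuity from the set being a neighbourhood of the origin. -/
theorem isMonotoneGauge (hL : IsRuinSet L) (hb : ∀ j, 0 < b j) :
    IsMonotoneGauge (gauge {x | b - x ∈ Lᶜ}) where
  continuous := continuous_gauge hL.convex_preimage (hL.compl_mem_nhds hb)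
  nonneg := gauge_nonneg
  mono := by
    intro x y hxy
    have habs := absorbent_nhds_zero (𝕜 := ℝ) (hL.compl_mem_nhds hb)
    refine csInf_le_csInf ⟨0, fun r hr => le_of_lt hr.1⟩ habs.gauge_set_nonempty ?_
    rintro r ⟨hr, hy⟩
    refine ⟨hr, ?_⟩
    have hr : 0 < r := hr
    rw [mem_smul_set_iff_inv_smul_mem₀ hr.ne'] at hy ⊢
    intro hx
    refine hy (hL.decreasing ?_ hx)
    exact sub_le_sub_left (smul_le_smul_of_nonneg_left hxy (inv_pos.2 hr).le) b
  add_le := gauge_add_le hL.convex_preimage (absorbent_nhds_zero (hL.compl_mem_nhds hb))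
  smul r hr x := by rw [gauge_smul_of_nonneg hr, smul_eq_mul]

/-- As `L` is open, the convex set is closed and equals the unit sublevel set of its gauge. -/
theorem one_lt_gauge_iff (hL : IsRuinSet L) (hb : ∀ j, 0 < b j) (x : Fin d → ℝ) :
    1 < gauge {x | b - x ∈ Lᶜ} x ↔ b - x ∈ L := by
  have hcl : IsClosed {x | b - x ∈ Lᶜ} :=
    hL.isOpen.isClosed_compl.preimage (continuous_const.sub continuous_id)
  rw [← not_le, gauge_le_one_iff_mem_closure hL.convex_preimage (hL.compl_mem_nhds hb),
    hcl.closure_eq, mem_ofPred_eq, mem_compl_iff, not_not]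

theorem lt_gauge_iff (hL : IsRuinSet L) (hb : ∀ j, 0 < b j) {u : ℝ} (hu : 0 < u)
    (x : Fin d → ℝ) : u < gauge {x | b - x ∈ Lᶜ} x ↔ u • b - x ∈ L := by
  rw [← (hL.isMonotoneGauge hb).lt_map_inv_smul hu, hL.one_lt_gauge_iff hb]
  conv_rhs => rw [← hL.cone u hu, mem_smul_set_iff_inv_smul_mem₀ hu.ne', smul_sub, smul_smul,
    inv_mul_cancel₀ hu.ne', one_smul]

end IsRuinSet

/-! ### Independence of the pairs of claims and interarrival times. -/

section Independence

variable {Ω E E' : Type*} [MeasurableSpace Ω] [MeasurableSpace E] [MeasurableSpace E']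
  {P : Measure Ω} {X : ℕ → Ω → E} {Y : ℕ → Ω → E'}

/-- Two independent sequences of independent variables form an independent sequence of pairs. -/
theorem iIndepFun_pair_of_indepFun (hXm : ∀ i, Measurable (X i)) (hYm : ∀ i, Measurable (Y i))
    (hX : iIndepFun X P) (hY : iIndepFun Y P)
    (hXY : IndepFun (fun ω i => X i ω) (fun ω i => Y i ω) P) :
    iIndepFun (fun i ω => (X i ω, Y i ω)) P := by
  -- Measurable rectangles form a generating π-system, on which the joint probability factors first
  -- between the two sequences and then over the indices.
  set R : Set (Set (E × E')) :=
    image2 (· ×ˢ ·) {s : Set E | MeasurableSet s} {t : Set E' | MeasurableSet t} with hR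
  have hgen : ∀ i, MeasurableSpace.comap (fun ω => (X i ω, Y i ω)) inferInstance =
      MeasurableSpace.generateFrom (preimage (fun ω => (X i ω, Y i ω)) '' R) := fun i => by
    rw [← MeasurableSpace.comap_generateFrom, hR, generateFrom_prod]
  refine iIndepSets.iIndep (fun i => ((hXm i).prodMk (hYm i)).comap_le)
    (fun i => preimage (fun ω => (X i ω, Y i ω)) '' R) (fun i => isPiSystem_prod.comap _) hgen ?_
  rw [iIndepSets_iff]
  intro s f hf
  have hf' : ∀ i ∈ s, ∃ A : Set E, ∃ B : Set E', MeasurableSet A ∧ MeasurableSet B ∧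
      f i = X i ⁻¹' A ∩ Y i ⁻¹' B := by
    intro i hi
    obtain ⟨_, ⟨A, hA, B, hB, rfl⟩, h⟩ := hf i hi
    exact ⟨A, B, hA, hB, h.symm⟩
  choose! A B hA hB hAB using hf'
  have h1 : ⋂ i ∈ s, f i = (fun ω i => X i ω) ⁻¹' (Set.pi s A) ∩
      (fun ω i => Y i ω) ⁻¹' (Set.pi s B) := by
    ext ω
    simp only [mem_iInter, mem_inter_iff, mem_preimage, Set.mem_pi, Finset.mem_coe]
    constructor
    · intro h
      exact ⟨fun i hi => by have := h i hi; rw [hAB i hi] at this; exact this.1,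
        fun i hi => by have := h i hi; rw [hAB i hi] at this; exact this.2⟩
    · rintro ⟨h2, h3⟩ i hi
      rw [hAB i hi]
      exact ⟨h2 i hi, h3 i hi⟩
  have hX' : (fun ω i => X i ω) ⁻¹' (Set.pi s A) = ⋂ i ∈ s, X i ⁻¹' A i := by
    ext ω
    simp [Set.mem_pi]
  have hY' : (fun ω i => Y i ω) ⁻¹' (Set.pi s B) = ⋂ i ∈ s, Y i ⁻¹' B i := by
    ext ω
    simp [Set.mem_pi]
  rw [h1, hXY.measure_inter_preimage_eq_mul _ _ (MeasurableSet.pi s.countable_toSet hA)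
    (MeasurableSet.pi s.countable_toSet hB), hX', hY',
    hX.measure_inter_preimage_eq_mul s hA, hY.measure_inter_preimage_eq_mul s hB,
    ← Finset.prod_mul_distrib]
  refine Finset.prod_congr rfl fun i hi => ?_
  rw [hAB i hi]
  exact ((hXY.comp (measurable_pi_apply i) (measurable_pi_apply i)).measure_inter_preimage_eq_mul
    _ _ (hA i hi) (hB i hi)).symm

end Independence

/-! ### Reduction of ruin to the random walk. -/

section RiskReserve

variable {Ω : Type*} {d : ℕ} {X : ℕ → Ω → Fin d → ℝ} {Y : ℕ → Ω → ℝ} {p : Fin d → ℝ}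

theorem walk_eq_sum_sub_arrivalTime (n : ℕ) (ω : Ω) :
    walk (fun i ω => X i ω - Y i ω • p) n ω =
      (∑ i ∈ Finset.range n, X i ω) - arrivalTime Y n ω • p := by
  simp [walk, arrivalTime, Finset.sum_sub_distrib, Finset.sum_smul]

theorem arrivalTime_claimCount_le {t : ℝ} (ht : 0 ≤ t) (ω : Ω) :
    arrivalTime Y (claimCount Y t ω) ω ≤ t := by
  -- The case `0` includes the default value of `sSup` for empty and for unbounded sets.
  by_cases h0 : claimCount Y t ω = 0
  · simpa [h0, arrivalTime] using ht
  · have hbdd : BddAbove {n : ℕ | 1 ≤ n ∧ arrivalTime Y n ω ≤ t} := by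
      by_contra h
      exact h0 (Nat.sSup_of_not_bddAbove h)
    have hne : {n : ℕ | 1 ≤ n ∧ arrivalTime Y n ω ≤ t}.Nonempty := by
      by_contra h
      rw [not_nonempty_iff_eq_empty] at h
      exact h0 (by rw [claimCount, h, csSup_empty]; rfl)
    exact (Nat.sSup_mem hne hbdd).2

theorem claimCount_arrivalTime {ω : Ω} (hY : ∀ i, 0 < Y i ω) (n : ℕ) :
    claimCount Y (arrivalTime Y n ω) ω = n := by
  have hmono : StrictMono fun n => arrivalTime Y n ω := strictMono_nat_of_lt_succ fun n => by
    simp only [arrivalTime, Finset.sum_range_succ]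
    linarith [hY n]
  have hub : ∀ m ∈ {m : ℕ | 1 ≤ m ∧ arrivalTime Y m ω ≤ arrivalTime Y n ω}, m ≤ n :=
    fun m hm => hmono.le_iff_le.1 hm.2
  refine le_antisymm (csSup_le' hub) ?_
  rcases Nat.eq_zero_or_pos n with rfl | hn
  · exact Nat.zero_le _
  · exact le_csSup ⟨n, hub⟩ ⟨hn, le_rfl⟩

/-- Ruin can be detected by looking at the times of the claims only. -/
theorem exists_riskReserve_mem_iff {L : Set (Fin d → ℝ)} (hL : IsRuinSet L) {b : Fin d → ℝ}
    (hb : ∀ j, 0 < b j) (hp : ∀ j, 0 ≤ p j) {u : ℝ} (hu : 0 < u) {ω : Ω} (hY : ∀ i, 0 < Y i ω) :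
    (∃ t : ℝ, 0 ≤ t ∧ riskReserve X Y p b u t ω ∈ L) ↔
      ω ∈ exceedance (gauge {x | b - x ∈ Lᶜ}) (fun i ω => X i ω - Y i ω • p) u := by
  constructor
  · rintro ⟨t, ht, h⟩
    refine ⟨claimCount Y t ω, ?_⟩
    rw [riskReserve, ← hL.lt_gauge_iff hb hu] at h
    -- Premiums earned since the last claim only help, so the surplus at `t` is dominated by its
    -- value at that claim.
    refine h.trans_le ((hL.isMonotoneGauge hb).mono ?_)
    rw [walk_eq_sum_sub_arrivalTime, claimSurplus]
    exact sub_le_sub_left (smul_le_smul_of_nonneg_right (arrivalTime_claimCount_le ht ω) hp) _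
  · rintro ⟨n, hn⟩
    refine ⟨arrivalTime Y n ω, Finset.sum_nonneg fun i _ => (hY i).le, ?_⟩
    rw [riskReserve, ← hL.lt_gauge_iff hb hu, claimSurplus, claimCount_arrivalTime hY,
      ← walk_eq_sum_sub_arrivalTime]
    exact hn

end RiskReserve

/-! ### The ruin probability. -/

theorem proposition5p4 {Ω : Type*} [MeasurableSpace Ω] (P : Measure Ω) [IsProbabilityMeasure P]
    {d : ℕ}
    -- the claim sizes: i.i.d. random vectors with finite mean
    (X : ℕ → Ω → Fin d → ℝ) (hXm : ∀ i, Measurable (X i)) (hXindep : iIndepFun X P)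
    (hXident : ∀ i, IdentDistrib (X i) (X 0) P P) (hXint : Integrable (X 0) P)
    -- the interarrival times: i.i.d. and positive
    (Y : ℕ → Ω → ℝ) (hYm : ∀ i, Measurable (Y i)) (hYindep : iIndepFun Y P)
    (hYident : ∀ i, IdentDistrib (Y i) (Y 0) P P) (hYpos : ∀ i, ∀ᵐ ω ∂P, 0 < Y i ω)
    -- the claim sizes are independent of the arrival process
    (hXY : IndepFun (fun ω i => X i ω) (fun ω i => Y i ω) P)
    -- the premium rates and the allocation of the initial capital
    (p : Fin d → ℝ) (hp : ∀ j, 0 ≤ p j)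
    (b : Fin d → ℝ) (hb : ∀ j, 0 < b j) (hbsum : ∑ j, b j = 1)
    -- positive safety loading (as the integral of a non-integrable function is `0` by convention,
    -- its positivity includes that the mean is finite)
    (c : Fin d → ℝ) (hc : ∀ j, c j = -∫ ω, (X 0 ω j - Y 0 ω * p j) ∂P) (hcpos : ∀ j, 0 < c j)
    (L : Set (Fin d → ℝ)) (hL : IsRuinSet L)
    (α : ℝ) (hα : 1 < α) (μ : Measure (PuncturedExt d)) (hμ : IsMRV (P.map (X 0)) α μ)
    (hμpos : ∀ j, 0 < μ (finitePoints {x | 0 < x j})) :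
    (∫⁻ v in Ioi (0 : ℝ), μ (finitePoints ((fun x => b - x + v • c) '' L))) < ∞ ∧
    Tendsto (fun u : ℝ => ruinProb P X Y p b L u / (u * P.real {ω | u < l1Norm (X 0 ω)})) atTop
      (𝓝 (∫⁻ v in Ioi (0 : ℝ), μ (finitePoints ((fun x => b - x + v • c) '' L))).toReal) := by
  set g : (Fin d → ℝ) → ℝ := gauge {x | b - x ∈ Lᶜ} with hgdef
  have hg : IsMonotoneGauge g := hL.isMonotoneGauge hb
  set W : ℕ → Ω → Fin d → ℝ := fun i ω => Y i ω • p with hW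
  set Z : ℕ → Ω → Fin d → ℝ := fun i ω => X i ω - Y i ω • p with hZ
  have hWm : ∀ i, Measurable (W i) := fun i => (hYm i).smul_const p
  have hZm : ∀ i, Measurable (Z i) := fun i => (hXm i).sub (hWm i)
  have hpair := iIndepFun_pair_of_indepFun hXm hYm hXindep hYindep hXY
  have hφ : Measurable fun q : (Fin d → ℝ) × ℝ => q.1 - q.2 • p :=
    measurable_fst.sub (measurable_snd.smul_const p)
  have hindep : ∀ i, IndepFun (X i) (Y i) P := fun i =>
    hXY.comp (measurable_pi_apply i) (measurable_pi_apply i)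
  have hZindep : iIndepFun Z P := hpair.comp (fun _ q => q.1 - q.2 • p) fun _ => hφ
  have hZid : ∀ i, IdentDistrib (Z i) (Z 0) P P := fun i =>
    ((hXident i).prodMk (hYident i) (hindep i) (hindep 0)).comp hφ
  have hle : ∀ i, ∀ᵐ ω ∂P, Z i ω ≤ X i ω := fun i => by
    filter_upwards [hYpos i] with ω hω
    exact sub_le_self _ (smul_nonneg hω.le hp)
  have hZint : ∀ j, Integrable (fun ω => Z 0 ω j) P := fun j => by
    by_contra h
    have h1 := hc j
    have h2 : ∫ ω, (X 0 ω j - Y 0 ω * p j) ∂P = 0 := integral_undef h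
    rw [h2, neg_zero] at h1
    exact (hcpos j).ne' h1
  have hlim : ∀ᵐ ω ∂P, ∀ j, Tendsto (fun n : ℕ => walk Z n ω j / n) atTop (𝓝 (-c j)) := by
    filter_upwards [ae_tendsto_walk_div hZindep hZid hZint] with ω hω j
    have h1 : ∫ ω, Z 0 ω j ∂P = -c j := by
      rw [hc j, neg_neg]
      rfl
    rw [← h1]
    exact hω j
  have hF : IsProbabilityMeasure (P.map (X 0)) :=
    Measure.isProbabilityMeasure_map (hXm 0).aemeasurable
  have hset : ∀ v : ℝ, μ (finitePoints ((fun x => b - x + v • c) '' L)) =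
      realMeasure μ {x | 1 < g (x - v • c)} := fun v => by
    have hm : MeasurableSet {x | 1 < g (x - v • c)} := (isOpen_lt continuous_const
      (hg.continuous.comp (continuous_id.sub continuous_const))).measurableSet
    rw [realMeasure_apply hμ.charges_finite hm]
    congr 2
    ext x
    rw [mem_ofPred_eq, hgdef, hL.one_lt_gauge_iff hb]
    constructor
    · rintro ⟨y, hy, rfl⟩
      simpa using hy
    · intro h
      exact ⟨_, h, by simp⟩
  simp only [hset]
  refine ⟨(hμ.tendsto_lintegral hα hg hcpos).1, ?_⟩
  refine (tendsto_measure_exceedance_div hμ hα hg hcpos hZm hZindep hZid hXm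
    (fun i => (hXident i).map_eq) hle hWm
    (fun i => (hYident i).comp (measurable_id.smul_const p))
    (fun i => (hindep i).comp measurable_id (measurable_id.smul_const p))
    (fun i ω => rfl) hlim).congr' ?_
  filter_upwards [eventually_gt_atTop 0] with u hu
  congr 1
  · rw [ruinProb]
    refine measureReal_congr ?_
    filter_upwards [ae_all_iff.2 hYpos] with ω hω
    exact propext (exists_riskReserve_mem_iff hL hb hp hu hω).symm
  · rw [measureReal_def, Measure.map_apply (hXm 0)
      (isOpen_lt continuous_const continuous_l1Norm).measurableSet]
    rfl
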